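/- Let $\mathbb{F}$ be a field with $\operatorname{char}\mathbb{F}\neq 2$. *Circuits.* An arithmetic circuit over $\mathbb{F}$ and a set $X$ of variables is a finite directed acyclic graph in which every node (gate) has indegree $0$ or $2$ (the two incoming edges may come from the same gate); gates of indegree $0$ are labelled by an element of $\mathbb{F}\cup X$, and gates of indegree $2$ by $+$ or $\times$. Each gate computes a polynomial in $\mathbb{F}[X]$ in the obvious way, and the circuit computes $f$ if some gate computes $f$. Its size is the number of its gates of indegree $2$. For a gate $v$, the subcircuit $\Phi_v$ consists of all gates from which there is a directed path to $v$. The circuit is *multiplicatively disjoint* if for each $\times$-gate with children $v_1,v_2$ the subcircuits $\Phi_{v_1},\Phi_{v_2}$ are disjoint. It is *weakly skew* if each $\times$-gate $v$ has a child $v'$ such that there is only one edge connecting a gate of $\Phi_{v'}$ with a gate outside $\Phi_{v'}$, namely the edge $(v',v)$. *Classes.* We consider sequences $(f_n)_{n\in\mathbb{N}}$ of polynomials over $\mathbb{F}$, each $f_n$ having its own finite set of variables. Such a sequence is in $\mathrm{VP}$ (resp. $\mathrm{VBP}$) if there are multiplicatively disjoint (resp. weakly skew) circuits $\Phi_n$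 computing $f_n$ whose size is bounded by a polynomial in $n$. It is in $\mathrm{VNP}$ if there are $m(n)\in\mathbb{N}$ and a sequence $(g_n)\in\mathrm{VP}$, where $g_n$ has the variables $x$ of $f_n$ and $m(n)$ further variables, such that $f_n(x)=\sum_{e\in\{0,1\}^{m(n)}} g_n(x,e)$ for all $n$. *Reductions.* A polynomial $f$ is a projection of $g$ if $f$ is obtained from $g$ by substituting each variable of $g$ by a variable of $f$ or an element of $\mathbb{F}$. A sequence $(f_n)$ is a $p$-projection of $(g_n)$ if there is a polynomially bounded $t\colon\mathbb{N}\to\mathbb{N}$ such that $f_n$ is a projection of $g_{t(n)}$ for all $n$. Let $\mathrm{DET}=(\mathrm{DET}_n)$ and $\mathrm{PER}=(\mathrm{PER}_n)$ be the sequences of determinants and permanents of $n\times n$ matrices of independent variables over $\mathbb{F}$. Let $\mathrm{dc}(n)$ be the smallest $s$ such that $\mathrm{PER}_n=\det(A)$ for some $s\times s$ matrix $A$ whose entries are polynomials of degree at most $1$ over $\mathbb{F}$ in the variables of $\mathrm{PER}_n$. Then $\mathrm{VBP}\neq\mathrm{VNP}$ if and only if $\mathrm{PER}$ is not a $p$-projection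 of $\mathrm{DET}$. Moreover, $\mathrm{VBP}\neq\mathrm{VNP}$ if and only if $\mathrm{dc}(n)$ is not bounded by a polynomial in $n$. -/

import Mathlib

namespace Valiant

/-! ### Arithmetic circuits -/

/-- The label of a gate, together with the sources of its incoming edges: a gate of indegree zero
carries a field element or a variable, a gate of indegree two carries `+` or `×`. The two incoming
edges of an operation gate may start in the same gate. -/
inductive GateLabel (F X V : Type*) where
  | const (c : F) : GateLabel F X V
  | var (x : X) : GateLabel F X V
  | add (l r : V) : GateLabel F X V
  | mul (l r : V) : GateLabel F X V

namespace GateLabel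

variable {F X V : Type*}

/-- The source of the left (`false`) or right (`true`) incoming edge, if there is one. -/
def child : GateLabel F X V → Bool → Option V
  | const _, _ => none
  | var _, _ => none
  | add l r, s => some (if s then r else l)
  | mul l r, s => some (if s then r else l)

/-- Operation gates are the gates labelled `+` or `×`. -/
def IsOperation : GateLabel F X V → Prop
  | const _ => False
  | var _ => False
  | add _ _ => True
  | mul _ _ => True

end GateLabel

/-- There is an edge from the gate `u` to the gate `v`. -/
def IsChild {F X V : Type*} (label : V → GateLabel F X V) (u v : V) : Prop :=
  ∃ s : Bool, (label v).child s = some u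

/-- An arithmetic circuit over `F` and the set `X` of variables: a finite directed acyclic graph
whose nodes have indegree zero or two and are labelled accordingly. -/
structure Circuit (F X : Type*) where
  Gate : Type
  finite : Finite Gate
  label : Gate → GateLabel F X Gate
  acyclic : ∀ v, ¬ Relation.TransGen (IsChild label) v v

namespace Circuit

variable {F X : Type*}

/-- The size of a circuit is the number of its operation gates. -/
noncomputable def size (Φ : Circuit F X) : ℕ :=
  {v : Φ.Gate | (Φ.label v).IsOperation}.ncard

/-- The set of gates of the subcircuit with root `v`: all `u` with a directed path to `v`. -/
def subcircuit (Φ : Circuit F X) (v : Φ.Gate) : Set Φ.Gate :=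
  {u | Relation.ReflTransGen (IsChild Φ.label) u v}

theorem wellFounded_isChild (Φ : Circuit F X) : WellFounded (IsChild Φ.label) := by
  have := Φ.finite
  have : Std.Irrefl (Relation.TransGen (IsChild Φ.label)) := ⟨Φ.acyclic⟩
  exact Subrelation.wf (fun {_ _} h => Relation.TransGen.single h)
    (Finite.wellFounded_of_trans_of_irrefl (Relation.TransGen (IsChild Φ.label)))

section value

variable [CommSemiring F]

/-- The polynomial at a gate with the given label, in terms of the polynomials at its children. -/
noncomputable def evalLabel {V : Type*} (lab : GateLabel F X V)
    (ih : ∀ u, (∃ s : Bool, lab.child s = some u) → MvPolynomial X F) : MvPolynomial X F :=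
  match lab, ih with
  | .const c, _ => MvPolynomial.C c
  | .var x, _ => MvPolynomial.X x
  | .add l r, ih => ih l ⟨false, rfl⟩ + ih r ⟨true, rfl⟩
  | .mul l r, ih => ih l ⟨false, rfl⟩ * ih r ⟨true, rfl⟩

/-- The polynomial computed by the circuit at each gate. -/
noncomputable def value (Φ : Circuit F X) : Φ.Gate → MvPolynomial X F :=
  Φ.wellFounded_isChild.fix fun v ih => evalLabel (Φ.label v) ih

theorem value_eq (Φ : Circuit F X) (v : Φ.Gate) :
    Φ.value v = match Φ.label v with
      | .const c => MvPolynomial.C c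
      | .var x => MvPolynomial.X x
      | .add l r => Φ.value l + Φ.value r
      | .mul l r => Φ.value l * Φ.value r := by
  have h : Φ.value v = evalLabel (Φ.label v) fun u _ => Φ.value u :=
    WellFounded.fix_eq _ _ _
  rw [h]
  cases Φ.label v <;> rfl

/-- A circuit computes `f` if `f` is the polynomial computed at one of its gates. -/
def Computes (Φ : Circuit F X) (f : MvPolynomial X F) : Prop :=
  ∃ v, Φ.value v = f

end value

/-- For each multiplication gate, the subcircuits of its two children are disjoint. -/
def MultiplicativelyDisjoint (Φ : Circuit F X) : Prop :=
  ∀ v l r, Φ.label v = .mul l r → Disjoint (Φ.subcircuit l) (Φ.subcircuit r)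

/-- Each multiplication gate `v` has a distinguished child `v'` (reached through its left or right
incoming edge, as recorded by `s`) such that this edge from `v'` to `v` is the only edge that leads
from a gate of the subcircuit of `v'` to a gate outside of it. (No edge leads from outside into a
subcircuit.) -/
def WeaklySkew (Φ : Circuit F X) : Prop :=
  ∀ v l r, Φ.label v = .mul l r →
    ∃ s v', (Φ.label v).child s = some v' ∧
      ∀ u ∈ Φ.subcircuit v', ∀ w ∉ Φ.subcircuit v', ∀ s',
        (Φ.label w).child s' = some u → u = v' ∧ w = v ∧ s' = s

end Circuit

/-! ### Sequences of polynomials and complexity classes -/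

/-- `t` is bounded by a polynomial in `n` (and in particular takes finite values). -/
def PolynomiallyBounded (t : ℕ → ℕ∞) : Prop :=
  ∃ p : Polynomial ℕ, ∀ n, t n ≤ ((p.eval n : ℕ) : ℕ∞)

/-- A sequence of multivariate polynomials over `F`; the `n`-th one has its own finite set of
variables. -/
structure PolySeq (F : Type*) [CommSemiring F] where
  Var : ℕ → Type
  finite : ∀ n, Finite (Var n)
  poly : ∀ n, MvPolynomial (Var n) F

section classes

variable (F : Type*) [Field F]

/-- Sequences computed by multiplicatively disjoint circuits of polynomial size. -/
def VP : Set (PolySeq F) :=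
  {f | ∃ Φ : ∀ n, Circuit F (f.Var n),
    (∀ n, (Φ n).MultiplicativelyDisjoint ∧ (Φ n).Computes (f.poly n)) ∧
    PolynomiallyBounded fun n => ((Φ n).size : ℕ∞)}

/-- Sequences computed by weakly skew circuits of polynomial size. -/
def VBP : Set (PolySeq F) :=
  {f | ∃ Φ : ∀ n, Circuit F (f.Var n),
    (∀ n, (Φ n).WeaklySkew ∧ (Φ n).Computes (f.poly n)) ∧
    PolynomiallyBounded fun n => ((Φ n).size : ℕ∞)}

/-- The `p`-definable sequences: `f n` is the sum of `g n (x, e)` over all `e ∈ {0,1}^(m n)`, where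
the sequence `g`, whose `n`-th member has `m n` additional variables, lies in `VP`. -/
def VNP : Set (PolySeq F) :=
  {f | ∃ (m : ℕ → ℕ) (g : ∀ n, MvPolynomial (f.Var n ⊕ Fin (m n)) F),
    (⟨fun n => f.Var n ⊕ Fin (m n), fun n => haveI := f.finite n; inferInstance, g⟩ :
      PolySeq F) ∈ VP F ∧
    ∀ n, f.poly n = ∑ e : Fin (m n) → Bool,
      MvPolynomial.aeval
        (Sum.elim (MvPolynomial.X : f.Var n → MvPolynomial (f.Var n) F)
          (fun i => if e i then 1 else 0)) (g n)}

/-- The sequence of determinants of `n × n` matrices of independent variables. -/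
noncomputable def DET : PolySeq F where
  Var n := Fin n × Fin n
  finite _ := inferInstance
  poly n := Matrix.det (Matrix.of fun i j : Fin n => (MvPolynomial.X (i, j) : MvPolynomial _ F))

/-- The sequence of permanents of `n × n` matrices of independent variables. -/
noncomputable def PER : PolySeq F where
  Var n := Fin n × Fin n
  finite _ := inferInstance
  poly n :=
    Matrix.permanent (Matrix.of fun i j : Fin n => (MvPolynomial.X (i, j) : MvPolynomial _ F))

end classes

section reductions

variable {F : Type*} [Field F]

/-- `f` is a projection of `g`: it arises from `g` by substituting each variable of `g` by a field
element or a variable of `f`. -/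
def IsProjection {X Y : Type*} (f : MvPolynomial X F) (g : MvPolynomial Y F) : Prop :=
  ∃ a : Y → F ⊕ X,
    f = MvPolynomial.aeval (fun y => Sum.elim MvPolynomial.C MvPolynomial.X (a y)) g

/-- `f` is a `p`-projection of `g`. -/
def IsPProjection (f g : PolySeq F) : Prop :=
  ∃ t : ℕ → ℕ, (PolynomiallyBounded fun n => (t n : ℕ∞)) ∧
    ∀ n, IsProjection (f.poly n) (g.poly (t n))

/-- The determinantal complexity of `f`: the smallest `s` such that `f` is the determinant of an
`s × s` matrix of polynomials of degree at most one (`⊤` if there were no such `s`). -/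
noncomputable def dc {X : Type*} (f : MvPolynomial X F) : ℕ∞ :=
  sInf {d : ℕ∞ | ∃ s : ℕ, d = s ∧ ∃ A : Matrix (Fin s) (Fin s) (MvPolynomial X F),
    (∀ i j, (A i j).totalDegree ≤ 1) ∧ f = A.det}

end reductions

end Valiant

/-! Both equivalences come from one cycle of implications: if VBP = VNP, then PER lies in VBP;
sequences in VBP are p-projections of DET; a p-projection of DET has polynomially bounded `dc`; and
a polynomial bound on the `dc` of the permanents forces VNP into VBP. The inclusion of VBP in VNP
always holds, since weakly skew circuits are multiplicatively disjoint.

PER is in VNP (`PER_mem_VNP`) by Ryser's formula, a sum over bits of a product that has a small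
weakly skew circuit.

A weakly skew circuit yields a projection of DET (`Circuit.WeaklySkew.exists_isProjection_DET`)
through a triangular linear system with one unknown per gate. At a product, the computation of the
closed child starts from the unknown of the other child instead of from 1, so no two unknowns are
ever multiplied. Cramer's rule expresses the output as a determinant whose entries are constants and
variables.

The last implication is `exists_weaklySkew_of_dc`. The value of a multiplicatively disjoint circuit
is a sum over selections of edges, essentially over its parse trees
(`Circuit.MultiplicativelyDisjoint.sum_prod_weight`), and each summand is a product of forms affine
in the selection bits (`Circuit.isGateWeight_gateForm`). A sum over bits of such a product is the
multilinear coefficient of a product of linear forms, that is, a permanent with affine entries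
(`exists_permanent_eq_sum`). This is where 1/2 is needed. The bound on `dc` turns this permanent
into a small determinant with affine entries, and determinants have small weakly skew circuits
(`exists_weaklySkew_det`) by a division-free recursion on the coefficients of det(1 - XB), where B
runs through the truncations of the matrix to its first rows. -/

namespace Valiant

/-! ### Circuits: subcircuits, skewness, pruning -/

namespace GateLabel

variable {F X Y V W : Type*}

/-- Relabel the input variables of a gate and rename its children. -/
def map (f : X → Y) (g : V → W) : GateLabel F X V → GateLabel F Y W
  | const c => const c
  | var x => var (f x)
  | add l r => add (g l) (g r)
  | mul l r => mul (g l) (g r)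

theorem child_map (f : X → Y) (g : V → W) (lab : GateLabel F X V) (s : Bool) :
    (lab.map f g).child s = (lab.child s).map g := by
  cases lab <;> cases s <;> rfl

end GateLabel

namespace Circuit

variable {F X : Type*}

theorem child_mem_subcircuit (Φ : Circuit F X) {u v : Φ.Gate} {s : Bool}
    (h : (Φ.label v).child s = some u) : u ∈ Φ.subcircuit v :=
  Relation.ReflTransGen.single ⟨s, h⟩

theorem mem_subcircuit_self (Φ : Circuit F X) (v : Φ.Gate) : v ∈ Φ.subcircuit v :=
  Relation.ReflTransGen.refl

theorem subcircuit_trans (Φ : Circuit F X) {u v w : Φ.Gate} (h₁ : u ∈ Φ.subcircuit v)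
    (h₂ : v ∈ Φ.subcircuit w) : u ∈ Φ.subcircuit w :=
  Relation.ReflTransGen.trans h₁ h₂

theorem subcircuit_mono (Φ : Circuit F X) {v w : Φ.Gate} (h : v ∈ Φ.subcircuit w) :
    Φ.subcircuit v ⊆ Φ.subcircuit w := fun _ hu => Φ.subcircuit_trans hu h

theorem notMem_subcircuit_of_child (Φ : Circuit F X) {u v : Φ.Gate} {s : Bool}
    (h : (Φ.label v).child s = some u) : v ∉ Φ.subcircuit u := fun hv =>
  Φ.acyclic v (Relation.TransGen.tail' hv ⟨s, h⟩)

theorem child_ne (Φ : Circuit F X) {u v : Φ.Gate} {s : Bool}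
    (h : (Φ.label v).child s = some u) : u ≠ v := by
  rintro rfl
  exact Φ.notMem_subcircuit_of_child h (Φ.mem_subcircuit_self _)

/-- A directed path from inside a down-closed set to a gate outside of it uses an edge that leaves
the set. -/
theorem exists_edge_leaving (Φ : Circuit F X) {S : Set Φ.Gate} {u v : Φ.Gate}
    (huv : u ∈ Φ.subcircuit v) (hu : u ∈ S) (hv : v ∉ S) :
    ∃ a ∈ S, ∃ b ∉ S, ∃ s, (Φ.label b).child s = some a ∧ b ∈ Φ.subcircuit v := by
  induction huv using Relation.ReflTransGen.head_induction_on with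
  | refl => exact absurd hu hv
  | head h' hcb ih =>
    rename_i a c
    by_cases hc : c ∈ S
    · exact ih hc
    · obtain ⟨s, hs⟩ := h'
      exact ⟨a, hu, c, hc, s, hs, hcb⟩

/-- The other child `w` is outside the closed subcircuit, since its edge to `v` is not the
distinguished one. A path to `w` from inside would have to leave along the edge into `v`, so that
`v` would lie below its own child. -/
theorem WeaklySkew.multiplicativelyDisjoint {Φ : Circuit F X} (h : Φ.WeaklySkew) :
    Φ.MultiplicativelyDisjoint := by
  intro v l r hv
  obtain ⟨s, v', hv', hout⟩ := h v l r hv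
  obtain ⟨w, hw⟩ : ∃ w, (Φ.label v).child (!s) = some w := by
    rw [hv]; cases s <;> exact ⟨_, rfl⟩
  have hvn : v ∉ Φ.subcircuit v' := Φ.notMem_subcircuit_of_child hv'
  have hwn : w ∉ Φ.subcircuit v' := fun hmem => by
    have := (hout w hmem v hvn _ hw).2.2
    cases s <;> simp at this
  have key : Disjoint (Φ.subcircuit v') (Φ.subcircuit w) := by
    rw [Set.disjoint_left]
    intro u hu huw
    obtain ⟨a, ha, b, hb, s', hs', hbw⟩ := Φ.exists_edge_leaving huw hu hwn
    obtain ⟨-, rfl, -⟩ := hout a ha b hb s' hs'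
    exact Φ.notMem_subcircuit_of_child hw hbw
  rw [hv] at hv' hw
  cases s
  · obtain rfl : l = v' := by simpa [GateLabel.child] using hv'
    obtain rfl : r = w := by simpa [GateLabel.child] using hw
    exact key
  · obtain rfl : r = v' := by simpa [GateLabel.child] using hv'
    obtain rfl : l = w := by simpa [GateLabel.child] using hw
    exact key.symm

section embedding

variable {Y : Type*}

/-- An injection of gates that respects labels and edges, up to a renaming of the variables. -/
structure Embedding (Ψ : Circuit F Y) (Φ : Circuit F X) (f : X → Y) where
  toFun : Ψ.Gate → Φ.Gate
  injective : Function.Injective toFun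
  label : ∀ v, (Ψ.label v).map id toFun = (Φ.label (toFun v)).map f id

namespace Embedding

variable {Ψ : Circuit F Y} {Φ : Circuit F X} {f : X → Y} (ι : Embedding Ψ Φ f)

theorem child_map (v : Ψ.Gate) (s : Bool) :
    ((Ψ.label v).child s).map ι.toFun = (Φ.label (ι.toFun v)).child s := by
  rw [← GateLabel.child_map id, ι.label, GateLabel.child_map, Option.map_id, id]

theorem child_iff (v u : Ψ.Gate) (s : Bool) :
    (Ψ.label v).child s = some u ↔ (Φ.label (ι.toFun v)).child s = some (ι.toFun u) := by
  rw [← ι.child_map]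
  constructor
  · intro h; rw [h]; rfl
  · intro h
    obtain ⟨a, ha, hau⟩ := Option.map_eq_some_iff.mp h
    rw [ha, ι.injective hau]

/-- Paths pull back because the image is closed under taking children: the edges into an image gate
are exactly the images of the edges into the original gate. -/
theorem mem_subcircuit_iff (u v : Ψ.Gate) :
    u ∈ Ψ.subcircuit v ↔ ι.toFun u ∈ Φ.subcircuit (ι.toFun v) := by
  constructor
  · intro h
    induction h with
    | refl => exact Φ.mem_subcircuit_self _
    | tail _ hc ih =>
      obtain ⟨s, hs⟩ := hc
      exact Φ.subcircuit_trans ih (Φ.child_mem_subcircuit ((ι.child_iff _ _ _).mp hs))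
  · intro h
    generalize hw : ι.toFun v = w at h
    induction h generalizing v with
    | refl => rw [ι.injective hw]; exact Ψ.mem_subcircuit_self _
    | tail hb hc ih =>
      obtain ⟨s, hs⟩ := hc
      rw [← hw, ← ι.child_map] at hs
      obtain ⟨a, ha, hab⟩ := Option.map_eq_some_iff.mp hs
      exact Ψ.subcircuit_trans (ih a hab) (Ψ.child_mem_subcircuit ha)

theorem label_mul {v l r : Ψ.Gate} (h : Ψ.label v = .mul l r) :
    Φ.label (ι.toFun v) = .mul (ι.toFun l) (ι.toFun r) := by
  have := ι.label v
  rw [h] at this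
  revert this
  cases Φ.label (ι.toFun v) <;> simp +contextual [GateLabel.map]

theorem multiplicativelyDisjoint (ι : Embedding Ψ Φ f) (h : Φ.MultiplicativelyDisjoint) :
    Ψ.MultiplicativelyDisjoint := by
  intro v l r hv
  have := h _ _ _ (ι.label_mul hv)
  rw [Set.disjoint_left] at this ⊢
  intro a ha hb
  exact this ((ι.mem_subcircuit_iff _ _).mp ha) ((ι.mem_subcircuit_iff _ _).mp hb)

theorem weaklySkew (ι : Embedding Ψ Φ f) (h : Φ.WeaklySkew) : Ψ.WeaklySkew := by
  intro v l r hv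
  obtain ⟨s, v', hv', hout⟩ := h _ _ _ (ι.label_mul hv)
  rw [← ι.child_map] at hv'
  obtain ⟨a, ha, rfl⟩ := Option.map_eq_some_iff.mp hv'
  refine ⟨s, a, ha, ?_⟩
  intro u hu w hw s' hs'
  obtain ⟨h₁, h₂, h₃⟩ := hout _ ((ι.mem_subcircuit_iff _ _).mp hu) _
    (fun hmem => hw ((ι.mem_subcircuit_iff _ _).mpr hmem)) s' ((ι.child_iff _ _ _).mp hs')
  exact ⟨ι.injective h₁, ι.injective h₂, h₃⟩

theorem value [CommSemiring F] (v : Ψ.Gate) :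
    Ψ.value v = MvPolynomial.rename f (Φ.value (ι.toFun v)) := by
  induction v using Ψ.wellFounded_isChild.induction with
  | _ v ih =>
    have hl := ι.label v
    rw [value_eq, value_eq]
    cases hv : Ψ.label v with
    | const c =>
      rw [hv] at hl; revert hl
      cases Φ.label (ι.toFun v) <;> simp +contextual [GateLabel.map]
    | var x =>
      rw [hv] at hl; revert hl
      cases Φ.label (ι.toFun v) <;> simp +contextual [GateLabel.map]
    | add l r =>
      have hL := ih l ⟨false, by rw [hv]; rfl⟩
      have hR := ih r ⟨true, by rw [hv]; rfl⟩
      rw [hv] at hl; revert hl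
      cases Φ.label (ι.toFun v) <;> simp +contextual [GateLabel.map]
      rintro rfl rfl
      rw [hL, hR]
    | mul l r =>
      have hL := ih l ⟨false, by rw [hv]; rfl⟩
      have hR := ih r ⟨true, by rw [hv]; rfl⟩
      rw [hv] at hl; revert hl
      cases Φ.label (ι.toFun v) <;> simp +contextual [GateLabel.map]
      rintro rfl rfl
      rw [hL, hR]

end Embedding

/-- The circuit with its variables renamed. -/
def mapVar (f : X → Y) (Φ : Circuit F X) : Circuit F Y where
  Gate := Φ.Gate
  finite := Φ.finite
  label v := (Φ.label v).map f id
  acyclic := by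
    have : IsChild (fun v => (Φ.label v).map f id) = IsChild Φ.label := by
      ext u v
      simp [IsChild, GateLabel.child_map]
    rw [this]
    exact Φ.acyclic

/-- The renamed circuit has the gates of the original one. -/
def mapVarEmbedding (f : X → Y) (Φ : Circuit F X) : Embedding (Φ.mapVar f) Φ f where
  toFun := fun v => v
  injective _ _ h := h
  label v := by
    change ((Φ.label v).map f id).map id id = (Φ.label v).map f id
    cases Φ.label v <;> rfl

theorem mapVar_size (f : X → Y) (Φ : Circuit F X) : (Φ.mapVar f).size = Φ.size := by
  unfold size
  congr 1
  ext v
  change ((Φ.label v).map f id).IsOperation ↔ (Φ.label v).IsOperation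
  cases Φ.label v <;> rfl

end embedding

section prune

/-- The label of a gate of a subcircuit, whose children also belong to the subcircuit. -/
def pruneLabel {V : Type*} (S : Set V) (lab : GateLabel F X V)
    (h : ∀ s u, lab.child s = some u → u ∈ S) : GateLabel F X S :=
  match lab, h with
  | .const c, _ => .const c
  | .var x, _ => .var x
  | .add l r, h => .add ⟨l, h false l rfl⟩ ⟨r, h true r rfl⟩
  | .mul l r, h => .mul ⟨l, h false l rfl⟩ ⟨r, h true r rfl⟩

theorem pruneLabel_map {V : Type*} (S : Set V) (lab : GateLabel F X V)
    (h : ∀ s u, lab.child s = some u → u ∈ S) :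
    (pruneLabel S lab h).map id Subtype.val = lab.map id id := by
  cases lab <;> rfl

variable (Φ : Circuit F X) (o : Φ.Gate)

/-- The subcircuit with the given root, as a circuit. -/
def prune : Circuit F X where
  Gate := Φ.subcircuit o
  finite := haveI := Φ.finite; inferInstance
  label v := pruneLabel (Φ.subcircuit o) (Φ.label v) fun _ _ h =>
    Φ.subcircuit_trans (Φ.child_mem_subcircuit h) v.2
  acyclic := by
    intro v hv
    apply Φ.acyclic v.1
    refine Relation.TransGen.lift (fun v : Φ.subcircuit o => v.1) (fun a b => ?_) _ _ hv
    rintro ⟨s, hs⟩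
    refine ⟨s, ?_⟩
    have := congrArg (Option.map Subtype.val) hs
    rw [← GateLabel.child_map id, pruneLabel_map, GateLabel.child_map] at this
    simpa using this

/-- The inclusion of a subcircuit. -/
def pruneEmbedding : Embedding (Φ.prune o) Φ id where
  toFun := fun v => v.1
  injective _ _ h := Subtype.ext h
  label _ := pruneLabel_map _ _ _

/-- The root of the pruned circuit. -/
def pruneRoot : (Φ.prune o).Gate := ⟨o, Φ.mem_subcircuit_self o⟩

theorem prune_rooted (u : (Φ.prune o).Gate) : u ∈ (Φ.prune o).subcircuit (Φ.pruneRoot o) :=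
  ((Φ.pruneEmbedding o).mem_subcircuit_iff _ _).mpr u.2

theorem prune_value [CommSemiring F] : (Φ.prune o).value (Φ.pruneRoot o) = Φ.value o := by
  rw [(Φ.pruneEmbedding o).value, MvPolynomial.rename_id_apply]
  rfl

theorem isOperation_of_child {V : Type*} {lab : GateLabel F X V} {s : Bool} {u : V}
    (h : lab.child s = some u) : lab.IsOperation := by
  cases lab <;> simp_all [GateLabel.child, GateLabel.IsOperation]

/-- Each gate other than the root has an outgoing edge, and there are two edges for each operation
gate. -/
theorem card_prune_le : Nat.card (Φ.prune o).Gate ≤ 2 * Φ.size + 1 := by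
  have := Φ.finite
  let Op := {v : Φ.Gate | (Φ.label v).IsOperation}
  have hex : ∀ u : Φ.subcircuit o, u.1 ≠ o →
      ∃ e : Op × Bool, (Φ.label e.1.1).child e.2 = some u.1 := by
    rintro ⟨u, hu⟩ hne
    rcases Relation.ReflTransGen.cases_head hu with h | ⟨c, ⟨s, hs⟩, -⟩
    · exact absurd h hne
    · exact ⟨⟨⟨c, isOperation_of_child hs⟩, s⟩, hs⟩
  choose e he using hex
  classical
  let g : Φ.subcircuit o → Option (Op × Bool) := fun u =>
    if h : u.1 = o then none else some (e u h)
  have hg : Function.Injective g := by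
    intro a b hab
    simp only [g] at hab
    split_ifs at hab with h₁ h₂ h₂
    · exact Subtype.ext (h₁.trans h₂.symm)
    · have := Option.some.inj hab
      have h := he a h₁
      rw [this, he b h₂] at h
      exact Subtype.ext (Option.some.inj h).symm
  have := Nat.card_le_card_of_injective g hg
  rw [Finite.card_option, Nat.card_prod, Nat.card_coe_set_eq] at this
  simp only [Nat.card_eq_fintype_card, Fintype.card_bool] at this
  change Nat.card (Φ.subcircuit o) ≤ _
  unfold size
  rw [mul_comm]
  simpa [Op] using this

end prune

/-- A relation on gates along which some rank increases is acyclic. -/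
theorem acyclic_of_rank {V : Type*} {label : V → GateLabel F X V} (rank : V → ℕ)
    (h : ∀ v s u, (label v).child s = some u → rank u < rank v) (v : V) :
    ¬ Relation.TransGen (IsChild label) v v := by
  intro hv
  have : ∀ a b, Relation.TransGen (IsChild label) a b → rank a < rank b := by
    intro a b hab
    induction hab with
    | single h' => obtain ⟨s, hs⟩ := h'; exact h _ _ _ hs
    | tail _ h' ih => obtain ⟨s, hs⟩ := h'; exact ih.trans (h _ _ _ hs)
  exact lt_irrefl _ (this v v hv)

end Circuit

end Valiant

namespace Valiant

/-! ### Weakly skew circuits from triangular linear systems -/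

section linearSystem

variable {F σ : Type*}

/-- The gates of the circuit that solves a triangular linear system with `N` unknowns: a leaf and a
product for each coefficient, and the partial sums of each row. -/
abbrev RecursionGate (N : ℕ) : Type := (Fin N × Fin N) ⊕ (Fin N × Fin N) ⊕ (Fin N × Fin (N + 1))

/-- The labels of the circuit that solves a triangular linear system. -/
def recursionLabel [Zero F] {N : ℕ} (rank : Fin N → ℕ) (b : Fin N → F) (T : Fin N → Fin N → F ⊕ σ) :
    RecursionGate N → GateLabel F σ (RecursionGate N)
  | .inl (v, u) => Sum.elim .const .var (T v u)
  | .inr (.inl (v, u)) => if rank u < rank v then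
      .mul (.inl (v, u)) (.inr (.inr (u, Fin.last N))) else .const 0
  | .inr (.inr (v, k)) => Fin.cases (.const (b v))
      (fun k => .add (.inr (.inr (v, k.castSucc))) (.inr (.inl (v, k)))) k

/-- A rank function for the gates of the circuit that solves a triangular linear system. -/
def recursionRank {N : ℕ} (rank : Fin N → ℕ) : RecursionGate N → ℕ
  | .inl _ => 0
  | .inr (.inl (v, _)) => (rank v + 1) * (N + 2)
  | .inr (.inr (v, k)) => (rank v + 1) * (N + 2) + k

theorem recursionRank_lt [Zero F] {N : ℕ} (rank : Fin N → ℕ) (b : Fin N → F)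
    (T : Fin N → Fin N → F ⊕ σ) (v : RecursionGate N) (s : Bool) (u : RecursionGate N)
    (h : (recursionLabel rank b T v).child s = some u) :
    recursionRank rank u < recursionRank rank v := by
  match v with
  | .inl (v, w) =>
    simp only [recursionLabel] at h
    cases hT : T v w <;> simp [hT, GateLabel.child] at h
  | .inr (.inl (v, w)) =>
    simp only [recursionLabel] at h
    split_ifs at h with hlt
    · cases s
      · obtain rfl := Option.some.inj h
        simp [recursionRank]
      · obtain rfl := Option.some.inj h
        -- The row of `w` reaches only `N` above its base level, less than the spacing `N + 2`
        -- between consecutive ranks.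
        have h₁ : (rank w + 1 + 1) * (N + 2) ≤ (rank v + 1) * (N + 2) :=
          Nat.mul_le_mul_right _ (by omega)
        simp only [recursionRank, if_true, Fin.val_last]
        linarith
    · simp [GateLabel.child] at h
  | .inr (.inr (v, k)) =>
    simp only [recursionLabel] at h
    induction k using Fin.cases with
    | zero => simp [GateLabel.child] at h
    | succ k =>
      cases s <;> obtain rfl := Option.some.inj h <;> simp [recursionRank]

/-- The circuit that solves a triangular linear system. -/
abbrev recursionCircuit [Zero F] {N : ℕ} (rank : Fin N → ℕ) (b : Fin N → F)
    (T : Fin N → Fin N → F ⊕ σ) : Circuit F σ where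
  Gate := RecursionGate N
  finite := inferInstance
  label := recursionLabel rank b T
  acyclic := Circuit.acyclic_of_rank (recursionRank rank) (recursionRank_lt rank b T)

/-- Each product has its own leaf for the coefficient, and this leaf is the closed child. The gates
for the unknowns may be reused without restriction. -/
theorem recursionCircuit_weaklySkew [Zero F] {N : ℕ} (rank : Fin N → ℕ) (b : Fin N → F)
    (T : Fin N → Fin N → F ⊕ σ) : (recursionCircuit rank b T).WeaklySkew := by
  intro v l r hv
  change recursionLabel rank b T v = _ at hv
  match v with
  | .inl (v, w) =>
    simp only [recursionLabel] at hv
    cases hT : T v w <;> simp [hT] at hv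
  | .inr (.inr (v, k)) =>
    simp only [recursionLabel] at hv
    induction k using Fin.cases <;> simp at hv
  | .inr (.inl (v, w)) =>
    have hlab := hv
    simp only [recursionLabel] at hv
    split_ifs at hv with hlt
    obtain ⟨rfl, rfl⟩ := GateLabel.mul.inj hv
    refine ⟨false, .inl (v, w), congrArg (fun l => l.child false) hlab, ?_⟩
    intro u hu a _ s' hs'
    have hu' : u = .inl (v, w) := by
      rcases Relation.ReflTransGen.cases_tail hu with h | ⟨c, -, s, hs⟩
      · exact h.symm
      · change (recursionLabel rank b T (.inl (v, w))).child s = some c at hs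
        simp only [recursionLabel] at hs
        cases hT : T v w <;> simp [hT, GateLabel.child] at hs
    subst hu'
    refine ⟨rfl, ?_⟩
    change (recursionLabel rank b T a).child s' = _ at hs'
    match a with
    | .inl (v', w') =>
      simp only [recursionLabel] at hs'
      cases hT : T v' w' <;> simp [hT, GateLabel.child] at hs'
    | .inr (.inr (v', k)) =>
      simp only [recursionLabel] at hs'
      induction k using Fin.cases <;> cases s' <;> simp [GateLabel.child] at hs'
    | .inr (.inl (v', w')) =>
      simp only [recursionLabel] at hs'
      split_ifs at hs'
      · cases s'
        · obtain ⟨rfl, rfl⟩ := Prod.mk.inj (Sum.inl.inj (Option.some.inj hs'))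
          exact ⟨rfl, rfl⟩
        · simp [GateLabel.child] at hs'
      · simp [GateLabel.child] at hs'

theorem recursionCircuit_size [Zero F] {N : ℕ} (rank : Fin N → ℕ) (b : Fin N → F)
    (T : Fin N → Fin N → F ⊕ σ) : (recursionCircuit rank b T).size ≤ 3 * (N + 1) ^ 2 := by
  have h : (recursionCircuit rank b T).size ≤ Nat.card (RecursionGate N) := by
    rw [← Set.ncard_univ]
    have : Finite (recursionCircuit rank b T).Gate := (recursionCircuit rank b T).finite
    exact Set.ncard_le_ncard (Set.subset_univ _)
  refine h.trans ?_
  simp only [Nat.card_eq_fintype_card, Fintype.card_sum, Fintype.card_prod, Fintype.card_fin]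
  nlinarith

open MvPolynomial in
theorem recursionCircuit_value [CommSemiring F] {N : ℕ} (rank : Fin N → ℕ)
    (p : Fin N → MvPolynomial σ F) (b : Fin N → F) (T : Fin N → Fin N → F ⊕ σ)
    (hp : ∀ v, p v = C (b v) + ∑ u with rank u < rank v, Sum.elim C X (T v u) * p u) (v : Fin N) :
    (recursionCircuit rank b T).value (.inr (.inr (v, Fin.last N)) : RecursionGate N) = p v := by
  induction hn : rank v using Nat.strong_induction_on generalizing v with
  | _ n ih =>
    subst hn
    have hmul : ∀ u, (recursionCircuit rank b T).value (.inr (.inl (v, u)) : RecursionGate N) =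
        if rank u < rank v then Sum.elim C X (T v u) * p u else 0 := by
      intro u
      rw [Circuit.value_eq]
      change (match recursionLabel rank b T (.inr (.inl (v, u))) with | _ => _) = _
      split_ifs with hlt
      · simp only [recursionLabel, if_pos hlt]
        rw [ih _ hlt u rfl, Circuit.value_eq]
        change (match recursionLabel rank b T (.inl (v, u)) with | _ => _) * _ = _
        simp only [recursionLabel]
        cases T v u <;> rfl
      · simp only [recursionLabel, if_neg hlt, map_zero]
    -- Partial sums run through all `u` in the order of `Fin N`, which need not be the order of the
    -- ranks; terms of too large rank have been replaced by the leaf 0.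
    have hsum : ∀ k, (recursionCircuit rank b T).value (.inr (.inr (v, k)) : RecursionGate N) =
        C (b v) + ∑ u with u.castSucc < k,
          if rank u < rank v then Sum.elim C X (T v u) * p u else 0 := by
      intro k
      induction k using Fin.induction with
      | zero =>
        rw [Circuit.value_eq]
        change (match recursionLabel rank b T (.inr (.inr (v, 0))) with | _ => _) = _
        simp
      | succ k ihk =>
        rw [Circuit.value_eq]
        change (match recursionLabel rank b T (.inr (.inr (v, k.succ))) with | _ => _) = _
        dsimp only
        rw [ihk, hmul]
        have : (Finset.univ.filter fun u : Fin N => u.castSucc < k.succ) =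
            insert k (Finset.univ.filter fun u : Fin N => u.castSucc < k.castSucc) := by
          ext u
          simp only [Finset.mem_filter, Finset.mem_univ, true_and, Finset.mem_insert,
            Fin.lt_def, Fin.ext_iff, Fin.val_castSucc, Fin.val_succ]
          omega
        rw [this, Finset.sum_insert (by simp)]
        ring
    rw [hsum, hp v, Finset.sum_filter (p := fun u => rank u < rank v)]
    congr 1
    rw [Finset.filter_true_of_mem fun u _ => Fin.castSucc_lt_last u]

open MvPolynomial in
/-- The solutions of a triangular linear system whose coefficients are constants and variables are
computed by small weakly skew circuits. -/
theorem exists_weaklySkew_of_recursion [CommSemiring F] {V : Type*} [Fintype V] (rank : V → ℕ)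
    (p : V → MvPolynomial σ F) (b : V → F) (T : V → V → F ⊕ σ)
    (hp : ∀ v, p v = C (b v) + ∑ u with rank u < rank v, Sum.elim C X (T v u) * p u) (v : V) :
    ∃ Φ : Circuit F σ, Φ.WeaklySkew ∧ Φ.Computes (p v) ∧
      Φ.size ≤ 3 * (Fintype.card V + 1) ^ 2 := by
  let e := Fintype.equivFin V
  refine ⟨recursionCircuit (fun i => rank (e.symm i)) (fun i => b (e.symm i))
    (fun i j => T (e.symm i) (e.symm j)), recursionCircuit_weaklySkew _ _ _,
    ⟨(.inr (.inr (e v, Fin.last _)) : RecursionGate _), ?_⟩, recursionCircuit_size _ _ _⟩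
  rw [recursionCircuit_value _ (fun i => p (e.symm i)), e.symm_apply_apply]
  intro i
  rw [hp, Finset.sum_filter, Finset.sum_filter]
  congr 1
  exact (Equiv.sum_comp e.symm
    (fun u => if rank u < rank (e.symm i) then Sum.elim C X (T (e.symm i) u) * p u else 0)).symm

end linearSystem

/-! ### Triangular systems with affine coefficients. -/

section span

variable {F σ : Type*} [Field F]

open MvPolynomial

/-- The polynomials of degree at most one in the variables from a given set. -/
noncomputable def affineSpan (F : Type*) {σ : Type*} [Field F] (Y : Set σ) : Submodule F (MvPolynomial σ F) :=
  Submodule.span F (insert 1 (MvPolynomial.X '' Y))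

theorem one_mem_affineSpan (Y : Set σ) : (1 : MvPolynomial σ F) ∈ affineSpan F Y :=
  Submodule.subset_span (Set.mem_insert _ _)

theorem X_mem_affineSpan {Y : Set σ} {y : σ} (hy : y ∈ Y) :
    (X y : MvPolynomial σ F) ∈ affineSpan F Y :=
  Submodule.subset_span (Set.mem_insert_of_mem _ ⟨y, hy, rfl⟩)

/-- The combinations of `1` and the polynomials of smaller rank with coefficients of degree at most
one in the variables from `Y`. -/
noncomputable def recursionSpan {V : Type*} (rank : V → ℕ) (p : V → MvPolynomial σ F) (Y : Set σ) (n : ℕ) :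
    Submodule F (MvPolynomial σ F) :=
  Submodule.span F (insert 1 {q | ∃ u, rank u < n ∧ (q = p u ∨ ∃ y ∈ Y, q = X y * p u)})

variable {V : Type*} {rank : V → ℕ} {p : V → MvPolynomial σ F} {Y : Set σ} {n : ℕ}

theorem one_mem_recursionSpan : (1 : MvPolynomial σ F) ∈ recursionSpan rank p Y n :=
  Submodule.subset_span (Set.mem_insert _ _)

theorem mem_recursionSpan {u : V} (hu : rank u < n) : p u ∈ recursionSpan rank p Y n :=
  Submodule.subset_span (Set.mem_insert_of_mem _ ⟨u, hu, Or.inl rfl⟩)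

theorem mul_mem_recursionSpan {u : V} (hu : rank u < n) {a : MvPolynomial σ F}
    (ha : a ∈ affineSpan F Y) : a * p u ∈ recursionSpan rank p Y n := by
  induction ha using Submodule.span_induction with
  | mem a ha =>
    rcases ha with rfl | ⟨y, hy, rfl⟩
    · rw [one_mul]; exact mem_recursionSpan hu
    · exact Submodule.subset_span (Set.mem_insert_of_mem _ ⟨u, hu, Or.inr ⟨y, hy, rfl⟩⟩)
  | zero => rw [zero_mul]; exact Submodule.zero_mem _
  | add a b _ _ ha hb => rw [add_mul]; exact Submodule.add_mem _ ha hb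
  | smul c a _ ha => rw [smul_mul_assoc]; exact Submodule.smul_mem _ _ ha

/-- The coefficients of a member of the span, in terms of the unknowns and their products with the
variables. -/
theorem exists_coeff_of_mem_recursionSpan [Fintype V] [Fintype Y] {q : MvPolynomial σ F}
    (hq : q ∈ recursionSpan rank p Y n) :
    ∃ (b : F) (c : V → Option Y → F), q = C b + ∑ u with rank u < n, ∑ o : Option Y,
      C (c u o) * (o.elim 1 (fun y => X y.1) * p u) := by
  classical
  induction hq using Submodule.span_induction with
  | mem q hq =>
    rcases hq with rfl | ⟨u, hu, hq⟩
    · exact ⟨1, 0, by simp⟩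
    · obtain ⟨o, ho⟩ : ∃ o : Option Y, q = o.elim 1 (fun y => X y.1) * p u := by
        rcases hq with rfl | ⟨y, hy, rfl⟩
        · exact ⟨none, by simp⟩
        · exact ⟨some ⟨y, hy⟩, rfl⟩
      refine ⟨0, fun u' o' => if u' = u ∧ o' = o then 1 else 0, ?_⟩
      rw [map_zero, zero_add, Finset.sum_eq_single u, Finset.sum_eq_single o, ho]
      · simp
      · intro o' _ ho'; simp [ho']
      · simp
      · intro u' _ hu'; simp [hu']
      · simp [hu]
  | zero => exact ⟨0, 0, by simp⟩
  | add q r _ _ hq hr =>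
    obtain ⟨b, c, rfl⟩ := hq
    obtain ⟨b', c', rfl⟩ := hr
    refine ⟨b + b', c + c', ?_⟩
    simp only [Pi.add_apply, map_add, add_mul, Finset.sum_add_distrib]
    ring
  | smul a q _ hq =>
    obtain ⟨b, c, rfl⟩ := hq
    refine ⟨a * b, fun u o => a * c u o, ?_⟩
    simp only [map_mul, smul_eq_C_mul, mul_add, Finset.mul_sum, mul_assoc]

/-- The solutions of a triangular linear system with affine coefficients are computed by small weakly
skew circuits. -/
theorem exists_weaklySkew_of_mem_recursionSpan [Fintype V] (rank : V → ℕ)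
    (p : V → MvPolynomial σ F) {Y : Set σ} (hY : Y.Finite)
    (hp : ∀ v, p v ∈ recursionSpan rank p Y (rank v)) (v : V) :
    ∃ Φ : Circuit F σ, Φ.WeaklySkew ∧ Φ.Computes (p v) ∧
      Φ.size ≤ 3 * (Fintype.card V * (Y.ncard + 1) + 1) ^ 2 := by
  classical
  have := hY.fintype
  choose b c hbc using fun v => exists_coeff_of_mem_recursionSpan (hp v)
  -- To reduce affine coefficients to constants and single variables, each product of a variable
  -- with an unknown becomes a further unknown. Doubling the ranks makes room for it directly above
  -- the old unknown.
  obtain ⟨r, hr₀, hr₁⟩ : ∃ r : V × Option Y → ℕ,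
      (∀ v, r (v, none) = 2 * rank v) ∧ ∀ v y, r (v, some y) = 2 * rank v + 1 :=
    ⟨fun w => 2 * rank w.1 + w.2.elim 0 fun _ => 1, fun _ => rfl, fun _ _ => rfl⟩
  have key := exists_weaklySkew_of_recursion (V := V × Option Y) r
    (fun w => w.2.elim 1 (fun y => X y.1) * p w.1)
    (fun w => w.2.elim (b w.1) fun _ => 0)
    (fun w u => w.2.elim (Sum.inl (c w.1 u.1 u.2)) fun y =>
      if u = (w.1, none) then Sum.inr y.1 else Sum.inl 0)
  obtain ⟨Φ, h₁, h₂, h₃⟩ := key (by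
    intro w
    rw [Finset.sum_filter]
    obtain ⟨v, _ | y⟩ := w
    · simp only [Option.elim_none, one_mul, Sum.elim_inl]
      conv_lhs => rw [hbc v]
      rw [Finset.sum_filter, Fintype.sum_prod_type]
      congr 1
      refine Finset.sum_congr rfl fun u _ => ?_
      by_cases hu : rank u < rank v
      · rw [if_pos hu]
        refine Finset.sum_congr rfl ?_
        rintro (_ | y) _
        · rw [if_pos (by rw [hr₀, hr₀]; omega)]
        · rw [if_pos (by rw [hr₀, hr₁]; omega)]
      · rw [if_neg hu]
        refine (Finset.sum_eq_zero ?_).symm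
        rintro (_ | y) _
        · rw [if_neg (by rw [hr₀, hr₀]; omega)]
        · rw [if_neg (by rw [hr₀, hr₁]; omega)]
    · simp only [Option.elim_some, map_zero, zero_add]
      rw [Finset.sum_eq_single (v, none), if_pos (by rw [hr₀, hr₁]; omega)]
      · simp
      · intro u _ hu; simp [hu]
      · simp) (v, none)
  refine ⟨Φ, h₁, by simpa using h₂, ?_⟩
  rwa [Fintype.card_prod, Fintype.card_option, ← Nat.card_eq_fintype_card (α := Y),
    Nat.card_coe_set_eq] at h₃

end span

end Valiant

namespace Valiant

/-! ### Determinants as solutions of triangular linear systems -/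

section determinant

open Polynomial Matrix

variable {R : Type*} [CommRing R] {s : ℕ}

/-- The matrix with the rows from the `k`-th on replaced by zero. -/
def truncateRows (A : Matrix (Fin s) (Fin s) R) (k : ℕ) : Matrix (Fin s) (Fin s) R :=
  Matrix.of fun i j => if i.val < k then A i j else 0

/-- The matrix `1 - X B` for the truncation `B` of `A` to its first `k` rows. -/
noncomputable def truncateChar (A : Matrix (Fin s) (Fin s) R) (k : ℕ) :
    Matrix (Fin s) (Fin s) R[X] :=
  1 - (X : R[X]) • (truncateRows A k).map C

/-- The `k`-th column of the adjugate of `1 - X B`, for the truncation `B` of `A` to its first `k`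
rows. -/
noncomputable def truncateColumn (A : Matrix (Fin s) (Fin s) R) (k : ℕ) : Fin s → R[X] :=
  (truncateChar A k).adjugate *ᵥ fun j => if j.val = k then 1 else 0

variable (A : Matrix (Fin s) (Fin s) R)

theorem det_truncateChar_zero : (truncateChar A 0).det = 1 := by
  have : truncateRows A 0 = 0 := by ext; simp [truncateRows]
  simp [truncateChar, this]

theorem truncateColumn_apply (k : Fin s) (j : Fin s) :
    truncateColumn A k j = (truncateChar A k).adjugate j k := by
  simp [truncateColumn, Matrix.mulVec, dotProduct, ← Fin.ext_iff]

/-- The two matrices differ only in row `k`, by `-X` times row `k` of `A`. The determinant is linear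
in that row, and the cofactors along it form column `k` of the adjugate. -/
theorem det_truncateChar_succ (k : Fin s) : (truncateChar A (k + 1)).det =
    (truncateChar A k).det - X * ∑ j, C (A k j) * truncateColumn A k j := by
  have h : truncateChar A (k + 1) = (truncateChar A k).updateRow k
      (truncateChar A k k + fun j => -(X * C (A k j))) := by
    refine Matrix.ext fun i j => ?_
    rcases eq_or_ne i k with rfl | hik
    · simp [truncateChar, truncateRows, Matrix.one_apply, sub_eq_add_neg]
    · rw [Matrix.updateRow_ne hik]
      have : i ≤ k ↔ i < k := ⟨fun h => lt_of_le_of_ne h hik, le_of_lt⟩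
      simp [truncateChar, truncateRows, this]
  rw [h, Matrix.det_updateRow_add, Matrix.updateRow_eq_self, ← Matrix.cramer_transpose_apply,
    Matrix.cramer_eq_adjugate_mulVec]
  simp only [← Matrix.adjugate_transpose, Matrix.mulVec, dotProduct, Matrix.transpose_apply,
    ← truncateColumn_apply]
  rw [sub_eq_add_neg, Finset.mul_sum, ← Finset.sum_neg_distrib]
  congr 1
  exact Finset.sum_congr rfl fun j _ => by ring

/-- This is the identity `M * adjugate M = det M • 1` for `M = 1 - X B`, applied to the `k`-th unit
vector and solved for the term without `X`. The factor `X` makes it a recursion on the degree of the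
coefficients. -/
theorem truncateColumn_eq (k : ℕ) (j : Fin s) : truncateColumn A k j =
    (if j.val = k then (truncateChar A k).det else 0) +
      X * ∑ i, C (truncateRows A k j i) * truncateColumn A k i := by
  have h : (truncateChar A k *ᵥ truncateColumn A k) j =
      if j.val = k then (truncateChar A k).det else 0 := by
    rw [truncateColumn, Matrix.mulVec_mulVec, Matrix.mul_adjugate, Matrix.smul_mulVec,
      Matrix.one_mulVec]
    simp
  rw [← h]
  simp only [truncateChar, Matrix.sub_mulVec, Matrix.one_mulVec, Matrix.smul_mulVec, Pi.sub_apply,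
    Pi.smul_apply, smul_eq_mul]
  simp [Matrix.mulVec, dotProduct]

/-- Without truncation, det(1 - XA) is the reversed characteristic polynomial, so its coefficient at
`X ^ s` is the constant term of the characteristic polynomial. -/
theorem det_eq_coeff_truncateChar : A.det = (-1) ^ s * (truncateChar A s).det.coeff s := by
  nontriviality R
  have h : truncateRows A s = A := by ext; simp [truncateRows]
  have h' : (truncateChar A s).det = A.charpolyRev := by rw [truncateChar, h]; rfl
  rw [h', Matrix.det_eq_sign_charpoly_coeff, ← Matrix.reverse_charpoly, Polynomial.coeff_reverse,
    Matrix.charpoly_natDegree_eq_dim]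
  simp

end determinant

section determinantCircuit

open MvPolynomial

variable {F σ : Type*} [Field F] {s : ℕ}

/-- Determinants of matrices with affine entries are computed by small weakly skew circuits. -/
theorem exists_weaklySkew_det (A : Matrix (Fin s) (Fin s) (MvPolynomial σ F)) {Y : Set σ}
    (hY : Y.Finite) (hA : ∀ i j, A i j ∈ affineSpan F Y) :
    ∃ Φ : Circuit F σ, Φ.WeaklySkew ∧ Φ.Computes A.det ∧
      Φ.size ≤ 3 * (((s + 1) ^ 3 + 1) * (Y.ncard + 1) + 1) ^ 2 := by
  let V := Option (Fin (s + 1) × Fin (s + 1) × Option (Fin s))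
  -- Lexicographic order on (truncation `i`, degree `k`), written in base `s + 2`. It is doubled so
  -- that coefficients of the column come just after the coefficient of the determinant for the same
  -- pair; the determinant of `A` itself comes last.
  obtain ⟨r, hr, hrq, hru⟩ : ∃ r : V → ℕ, r none = 2 * (s * (s + 2) + s) + 2 ∧
      (∀ i k, r (some (i, k, none)) = 2 * (i * (s + 2) + k)) ∧
      ∀ i k j, r (some (i, k, some j)) = 2 * (i * (s + 2) + k) + 1 :=
    ⟨fun v => v.elim _ fun v => 2 * (v.1 * (s + 2) + v.2.1) + v.2.2.elim 0 fun _ => 1,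
      rfl, fun _ _ => rfl, fun _ _ _ => rfl⟩
  obtain ⟨p, hp, hpq, hpu⟩ : ∃ p : V → MvPolynomial σ F, p none = A.det ∧
      (∀ i k, p (some (i, k, none)) = (truncateChar A i).det.coeff k) ∧
      ∀ i k j, p (some (i, k, some j)) = (truncateColumn A i j).coeff k :=
    ⟨fun v => v.elim A.det fun v => v.2.2.elim ((truncateChar A v.1).det.coeff v.2.1)
      fun j => (truncateColumn A v.1 j).coeff v.2.1, rfl, fun _ _ => rfl, fun _ _ _ => rfl⟩
  have key := exists_weaklySkew_of_mem_recursionSpan r p hY (v := none) (by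
    intro v
    match v with
    | none =>
      have h : (truncateChar A s).det.coeff s ∈ recursionSpan r p Y (r none) := by
        have := hpq (Fin.last s) (Fin.last s)
        simp only [Fin.val_last] at this
        rw [← this]
        refine mem_recursionSpan ?_
        rw [hr, hrq]
        simp
      rw [hp, det_eq_coeff_truncateChar]
      rcases neg_one_pow_eq_or (MvPolynomial σ F) s with h' | h' <;> rw [h']
      · rwa [one_mul]
      · rw [neg_one_mul]
        exact Submodule.neg_mem _ h
    | some (i, k, some j) =>
      rw [hpu, truncateColumn_eq, Polynomial.coeff_add]
      refine Submodule.add_mem _ ?_ ?_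
      · split_ifs
        · rw [← hpq]
          refine mem_recursionSpan ?_
          rw [hrq, hru]
          omega
        · rw [Polynomial.coeff_zero]
          exact Submodule.zero_mem _
      · induction k using Fin.cases with
        | zero => rw [Fin.val_zero, Polynomial.coeff_X_mul_zero]; exact Submodule.zero_mem _
        | succ k =>
          rw [Fin.val_succ, Polynomial.coeff_X_mul, Polynomial.finsetSum_coeff]
          refine Submodule.sum_mem _ fun l _ => ?_
          rw [Polynomial.coeff_C_mul]
          have := hpu i k.castSucc l
          rw [Fin.val_castSucc] at this
          rw [← this]
          refine mul_mem_recursionSpan ?_ ?_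
          · rw [hru, hru, Fin.val_castSucc, Fin.val_succ]
            omega
          · simp only [truncateRows, Matrix.of_apply]
            split_ifs
            · exact hA _ _
            · exact Submodule.zero_mem _
    | some (i, k, none) =>
      rw [hpq]
      induction i using Fin.cases with
      | zero =>
        rw [Fin.val_zero, det_truncateChar_zero, Polynomial.coeff_one]
        split_ifs
        · exact one_mem_recursionSpan
        · exact Submodule.zero_mem _
      | succ i =>
        rw [Fin.val_succ, det_truncateChar_succ, Polynomial.coeff_sub]
        refine Submodule.sub_mem _ ?_ ?_
        · have := hpq i.castSucc k
          rw [Fin.val_castSucc] at this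
          rw [← this]
          refine mem_recursionSpan ?_
          rw [hrq, hrq, Fin.val_castSucc, Fin.val_succ, Nat.add_mul i.val 1]
          omega
        · induction k using Fin.cases with
          | zero => rw [Fin.val_zero, Polynomial.coeff_X_mul_zero]; exact Submodule.zero_mem _
          | succ k =>
            rw [Fin.val_succ, Polynomial.coeff_X_mul, Polynomial.finsetSum_coeff]
            refine Submodule.sum_mem _ fun l _ => ?_
            rw [Polynomial.coeff_C_mul]
            have := hpu i.castSucc k.castSucc l
            rw [Fin.val_castSucc, Fin.val_castSucc] at this
            rw [← this]
            refine mul_mem_recursionSpan ?_ (hA _ _)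
            rw [hrq, hru, Fin.val_castSucc, Fin.val_castSucc, Fin.val_succ, Fin.val_succ,
              Nat.add_mul i.val 1]
            omega)
  obtain ⟨Φ, h₁, h₂, h₃⟩ := key
  refine ⟨Φ, h₁, hp ▸ h₂, h₃.trans ?_⟩
  have : Fintype.card V ≤ (s + 1) ^ 3 + 1 := by
    simp only [V, Fintype.card_option, Fintype.card_prod, Fintype.card_fin]
    nlinarith
  gcongr

end determinantCircuit

end Valiant

namespace Valiant

/-! ### Weakly skew circuits are projections of determinants -/

namespace Circuit

variable {F σ : Type*}

/-- For each multiplication gate a distinguished child, whose subcircuit is only entered from the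
gate. -/
structure Splitting (Φ : Circuit F σ) where
  closed : Φ.Gate → Φ.Gate
  other : Φ.Gate → Φ.Gate
  children : ∀ v l r, Φ.label v = .mul l r →
    closed v = l ∧ other v = r ∨ closed v = r ∧ other v = l
  leaving : ∀ v l r, Φ.label v = .mul l r → ∀ u ∈ Φ.subcircuit (closed v),
    ∀ w ∉ Φ.subcircuit (closed v), IsChild Φ.label u w → u = closed v ∧ w = v
  disjoint : ∀ v l r, Φ.label v = .mul l r →
    Disjoint (Φ.subcircuit (closed v)) (Φ.subcircuit (other v))

theorem WeaklySkew.exists_splitting {Φ : Circuit F σ} (h : Φ.WeaklySkew) :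
    Nonempty Φ.Splitting := by
  have hdis := h.multiplicativelyDisjoint
  have : ∀ v, ∃ c d, ∀ l r, Φ.label v = .mul l r → (c = l ∧ d = r ∨ c = r ∧ d = l) ∧
      (∀ u ∈ Φ.subcircuit c, ∀ w ∉ Φ.subcircuit c, IsChild Φ.label u w → u = c ∧ w = v) ∧
      Disjoint (Φ.subcircuit c) (Φ.subcircuit d) := by
    intro v
    by_cases hv : ∃ l r, Φ.label v = .mul l r
    · obtain ⟨l, r, hv⟩ := hv
      obtain ⟨s, c, hc, hout⟩ := h v l r hv
      have hd := hdis v l r hv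
      rw [hv] at hc
      cases s
      · obtain rfl : l = c := by simpa [GateLabel.child] using hc
        refine ⟨l, r, fun l' r' h' => ?_⟩
        obtain ⟨rfl, rfl⟩ := GateLabel.mul.inj (hv.symm.trans h')
        exact ⟨Or.inl ⟨rfl, rfl⟩, fun u hu w hw ⟨s', hs'⟩ =>
          ⟨(hout u hu w hw s' hs').1, (hout u hu w hw s' hs').2.1⟩, hd⟩
      · obtain rfl : r = c := by simpa [GateLabel.child] using hc
        refine ⟨r, l, fun l' r' h' => ?_⟩
        obtain ⟨rfl, rfl⟩ := GateLabel.mul.inj (hv.symm.trans h')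
        exact ⟨Or.inr ⟨rfl, rfl⟩, fun u hu w hw ⟨s', hs'⟩ =>
          ⟨(hout u hu w hw s' hs').1, (hout u hu w hw s' hs').2.1⟩, hd.symm⟩
    -- Default values at gates that are not products, where nothing is required.
    · exact ⟨v, v, fun l r h' => absurd ⟨l, r, h'⟩ hv⟩
  choose c d hcd using this
  exact ⟨⟨c, d, fun v l r h => (hcd v l r h).1, fun v l r h => (hcd v l r h).2.1,
    fun v l r h => (hcd v l r h).2.2⟩⟩

namespace Splitting

variable {Φ : Circuit F σ} (S : Φ.Splitting)

theorem isChild_closed {v l r : Φ.Gate} (h : Φ.label v = .mul l r) :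
    IsChild Φ.label (S.closed v) v := by
  rcases S.children v l r h with ⟨h', -⟩ | ⟨h', -⟩ <;> rw [h']
  · exact ⟨false, by rw [h]; rfl⟩
  · exact ⟨true, by rw [h]; rfl⟩

theorem isChild_other {v l r : Φ.Gate} (h : Φ.label v = .mul l r) :
    IsChild Φ.label (S.other v) v := by
  rcases S.children v l r h with ⟨-, h'⟩ | ⟨-, h'⟩ <;> rw [h']
  · exact ⟨true, by rw [h]; rfl⟩
  · exact ⟨false, by rw [h]; rfl⟩

/-- The multiplication gates whose closed subcircuit contains the given gate. -/
def blocks (u : Φ.Gate) : Set Φ.Gate :=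
  {v | (∃ l r, Φ.label v = .mul l r) ∧ u ∈ Φ.subcircuit (S.closed v)}

theorem self_notMem_blocks (v : Φ.Gate) : v ∉ S.blocks v := by
  rintro ⟨⟨l, r, hv⟩, hmem⟩
  obtain ⟨s, hs⟩ := S.isChild_closed hv
  exact Φ.notMem_subcircuit_of_child hs hmem

/-- The only edge that leaves a closed subcircuit goes from its root to its product gate, so every
other kind of edge stays within the same closed subcircuits. -/
theorem blocks_of_isChild {u v : Φ.Gate} (h : IsChild Φ.label u v)
    (hne : ∀ l r, Φ.label v = .mul l r → u ≠ S.closed v) : S.blocks u = S.blocks v := by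
  ext w
  refine and_congr_right fun ⟨l, r, hw⟩ => ⟨fun hu => ?_, fun hv => ?_⟩
  · by_contra hv
    obtain ⟨h₁, rfl⟩ := S.leaving w l r hw u hu v hv h
    exact hne l r hw h₁
  · obtain ⟨s, hs⟩ := h
    exact Φ.subcircuit_trans (Φ.child_mem_subcircuit hs) hv

theorem blocks_other {v l r : Φ.Gate} (h : Φ.label v = .mul l r) :
    S.blocks (S.other v) = S.blocks v := by
  refine S.blocks_of_isChild (S.isChild_other h) fun _ _ _ heq => ?_
  refine Set.disjoint_left.mp (S.disjoint v l r h) (Φ.mem_subcircuit_self _) ?_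
  rw [heq]
  exact Φ.mem_subcircuit_self _

theorem blocks_closed {v l r : Φ.Gate} (h : Φ.label v = .mul l r) :
    S.blocks (S.closed v) = insert v (S.blocks v) := by
  ext w
  constructor
  · rintro ⟨⟨l', r', hw⟩, hmem⟩
    by_cases hv : v ∈ Φ.subcircuit (S.closed w)
    · exact Or.inr ⟨⟨l', r', hw⟩, hv⟩
    · exact Or.inl (S.leaving w l' r' hw _ hmem v hv (S.isChild_closed h)).2.symm
  · rintro (rfl | ⟨hw, hmem⟩)
    · exact ⟨⟨l, r, h⟩, Φ.mem_subcircuit_self _⟩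
    · obtain ⟨s, hs⟩ := S.isChild_closed h
      exact ⟨hw, Φ.subcircuit_trans (Φ.child_mem_subcircuit hs) hmem⟩

/-- The multiplication gate whose closed subcircuit is the innermost one containing `u` is `v`. -/
def IsInnermost (u v : Φ.Gate) : Prop :=
  (∃ l r, Φ.label v = .mul l r) ∧ S.blocks u = insert v (S.blocks v)

/-- Two different candidates would each lie in the closed subcircuit of the other, which gives a
cycle. -/
theorem IsInnermost.unique {S : Φ.Splitting} {u v w : Φ.Gate} (hv : S.IsInnermost u v)
    (hw : S.IsInnermost u w) : v = w := by
  by_contra hne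
  have h : insert v (S.blocks v) = insert w (S.blocks w) := hv.2.symm.trans hw.2
  have h₁ : v ∈ S.blocks w := by
    have : v ∈ insert w (S.blocks w) := h ▸ Set.mem_insert _ _
    exact this.resolve_left hne
  have h₂ : w ∈ S.blocks v := by
    have : w ∈ insert v (S.blocks v) := h ▸ Set.mem_insert _ _
    exact this.resolve_left (Ne.symm hne)
  obtain ⟨l, r, hlab⟩ := hw.1
  obtain ⟨l', r', hlab'⟩ := hv.1
  obtain ⟨s, hs⟩ := S.isChild_closed hlab
  refine Φ.notMem_subcircuit_of_child hs (Φ.subcircuit_trans h₁.2 ?_)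
  obtain ⟨s', hs'⟩ := S.isChild_closed hlab'
  exact Φ.subcircuit_trans (Φ.child_mem_subcircuit hs') h₂.2

open Classical in
/-- The node at which the computation of a gate starts: the sibling of the root of the innermost
closed subcircuit, or the source. -/
noncomputable def start (u : Φ.Gate) : Option Φ.Gate :=
  if h : ∃ v, S.IsInnermost u v then some (S.other h.choose) else none

open Classical in
theorem start_congr {u v : Φ.Gate} (h : S.blocks u = S.blocks v) : S.start u = S.start v := by
  have : S.IsInnermost u = S.IsInnermost v := by
    ext w
    rw [IsInnermost, IsInnermost, h]
  have key : ∀ P Q : Φ.Gate → Prop, P = Q →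
      (if h : ∃ v, P v then some (S.other h.choose) else none) =
        if h : ∃ v, Q v then some (S.other h.choose) else none := by
    rintro P _ rfl
    rfl
  exact key _ _ this

theorem start_closed {v l r : Φ.Gate} (h : Φ.label v = .mul l r) :
    S.start (S.closed v) = some (S.other v) := by
  have hex : S.IsInnermost (S.closed v) v := ⟨⟨l, r, h⟩, S.blocks_closed h⟩
  have hex' : ∃ w, S.IsInnermost (S.closed v) w := ⟨v, hex⟩
  rw [start, dif_pos hex', hex'.choose_spec.unique hex]

theorem start_eq_some {u w : Φ.Gate} (h : S.start u = some w) :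
    ∃ v, S.IsInnermost u v ∧ w = S.other v := by
  rw [start] at h
  split_ifs at h with hex
  exact ⟨_, hex.choose_spec, (Option.some.inj h).symm⟩

/-- A closed subcircuit containing the output would contain every gate, in particular its own
product gate. -/
theorem start_root {o : Φ.Gate} (ho : ∀ u, u ∈ Φ.subcircuit o) : S.start o = none := by
  rw [start, dif_neg]
  rintro ⟨v, ⟨l, r, hv⟩, h⟩
  have : v ∈ S.blocks o := h ▸ Set.mem_insert _ _
  obtain ⟨s, hs⟩ := S.isChild_closed hv
  exact Φ.notMem_subcircuit_of_child hs (Φ.subcircuit_trans (ho v) this.2)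

open Classical in
/-- A rank function for which the linear system of the circuit is triangular. -/
noncomputable def rank (u : Φ.Gate) : ℕ :=
  (Φ.subcircuit u).ncard + ∑ᶠ v ∈ S.blocks u, (Φ.subcircuit (S.other v)).ncard

theorem ncard_subcircuit_lt {u v : Φ.Gate} (h : IsChild Φ.label u v) :
    (Φ.subcircuit u).ncard < (Φ.subcircuit v).ncard := by
  have := Φ.finite
  obtain ⟨s, hs⟩ := h
  refine Set.ncard_lt_ncard ⟨Φ.subcircuit_mono (Φ.child_mem_subcircuit hs), fun hle => ?_⟩
    (Set.toFinite _)
  exact Φ.notMem_subcircuit_of_child hs (hle (Φ.mem_subcircuit_self v))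

theorem rank_lt_of_isChild {u v : Φ.Gate} (h : IsChild Φ.label u v)
    (hne : ∀ l r, Φ.label v = .mul l r → u ≠ S.closed v) : S.rank u < S.rank v := by
  rw [rank, rank, S.blocks_of_isChild h hne]
  have := ncard_subcircuit_lt h
  omega

theorem finsum_blocks_insert {u v : Φ.Gate} (h : S.blocks u = insert v (S.blocks v)) :
    ∑ᶠ w ∈ S.blocks u, (Φ.subcircuit (S.other w)).ncard =
      (Φ.subcircuit (S.other v)).ncard +
        ∑ᶠ w ∈ S.blocks v, (Φ.subcircuit (S.other w)).ncard := by
  have := Φ.finite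
  rw [h, finsum_mem_insert _ (S.self_notMem_blocks v) (Set.toFinite _)]

/-- Entering the block of `v` adds the size of the other subcircuit to the rank. This is affordable
because the two subcircuits are disjoint and both omit `v`. -/
theorem rank_closed_lt {v l r : Φ.Gate} (h : Φ.label v = .mul l r) :
    S.rank (S.closed v) < S.rank v := by
  have := Φ.finite
  rw [rank, rank, S.finsum_blocks_insert (S.blocks_closed h)]
  have h₁ : (Φ.subcircuit (S.closed v) ∪ Φ.subcircuit (S.other v)).ncard <
      (Φ.subcircuit v).ncard := by
    obtain ⟨s, hs⟩ := S.isChild_closed h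
    obtain ⟨s', hs'⟩ := S.isChild_other h
    refine Set.ncard_lt_ncard ⟨Set.union_subset (Φ.subcircuit_mono (Φ.child_mem_subcircuit hs))
      (Φ.subcircuit_mono (Φ.child_mem_subcircuit hs')), fun hle => ?_⟩ (Set.toFinite _)
    rcases hle (Φ.mem_subcircuit_self v) with hmem | hmem
    · exact Φ.notMem_subcircuit_of_child hs hmem
    · exact Φ.notMem_subcircuit_of_child hs' hmem
  rw [Set.ncard_union_eq (S.disjoint v l r h) (Set.toFinite _) (Set.toFinite _)] at h₁
  omega

/-- The rank of `u` includes the size of the subcircuit of `w` through its innermost block, all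
further blocks are common to both gates, and the subcircuit of `u` itself is not empty. -/
theorem rank_start_lt {u w : Φ.Gate} (h : S.start u = some w) : S.rank w < S.rank u := by
  have := Φ.finite
  obtain ⟨v, ⟨⟨l, r, hv⟩, hb⟩, rfl⟩ := S.start_eq_some h
  rw [rank, rank, S.finsum_blocks_insert hb, S.blocks_other hv]
  have : 0 < (Φ.subcircuit u).ncard :=
    (Set.ncard_pos (Set.toFinite _)).mpr ⟨u, Φ.mem_subcircuit_self u⟩
  omega

end Splitting

end Circuit

end Valiant

namespace Valiant

open MvPolynomial

/-- A permutation other than the identity with no zero factor would never lower the rank and would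
raise it somewhere, although it preserves the sum of all ranks. Thus equal ranks are allowed and no
ordering of the indices is needed. -/
theorem det_eq_prod_of_rank {n R : Type*} [Fintype n] [DecidableEq n] [CommRing R]
    (M : Matrix n n R) (rank : n → ℕ) (h : ∀ i j, i ≠ j → M i j ≠ 0 → rank j < rank i) :
    M.det = ∏ i, M i i := by
  rw [Matrix.det_apply, Finset.sum_eq_single 1]
  · simp
  · intro π _ hπ
    obtain ⟨i, hi⟩ : ∃ i, π i ≠ i := by
      by_contra! hall
      exact hπ (Equiv.ext hall)
    suffices hz : ∃ j, M (π j) j = 0 by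
      obtain ⟨j, hj⟩ := hz
      have hprod : ∏ i, M (π i) i = 0 := Finset.prod_eq_zero (Finset.mem_univ j) hj
      rw [hprod, smul_zero]
    by_contra! hall
    have hle : ∀ j, rank j ≤ rank (π j) := fun j => by
      rcases eq_or_ne (π j) j with hj | hj
      · rw [hj]
      · exact (h _ _ hj (hall j)).le
    have hlt : ∑ j, rank j < ∑ j, rank (π j) :=
      Finset.sum_lt_sum (fun j _ => hle j) ⟨i, Finset.mem_univ i, h _ _ hi (hall i)⟩
    exact hlt.ne (Equiv.sum_comp π rank).symm
  · simp

theorem isProjection_DET_of_matrix {F σ I : Type*} [Field F] [Fintype I] [DecidableEq I]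
    (M : I → I → F ⊕ σ) :
    IsProjection (Matrix.det (Matrix.of fun i j => Sum.elim C X (M i j) : Matrix I I
      (MvPolynomial σ F))) ((DET F).poly (Fintype.card I)) := by
  let e := Fintype.equivFin I
  refine ⟨fun y => M (e.symm y.1) (e.symm y.2), ?_⟩
  change _ = aeval (fun y : Fin (Fintype.card I) × Fin (Fintype.card I) =>
    Sum.elim C X (M (e.symm y.1) (e.symm y.2)))
      (Matrix.det (Matrix.of fun i j => (X (i, j) : MvPolynomial _ F)))
  rw [AlgHom.map_det, ← Matrix.det_submatrix_equiv_self e.symm]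
  congr 1
  ext i j : 2
  simp [AlgHom.mapMatrix_apply]

namespace Circuit.Splitting

variable {F σ : Type*} [Field F] {Φ : Circuit F σ} (S : Φ.Splitting)

open Classical in
/-- The coefficients of the linear system of a circuit: each row expresses an unknown through the
ones of smaller rank. -/
noncomputable def system : Option Φ.Gate → Option Φ.Gate → F ⊕ σ
  | none, _ => .inl 0
  | some v, u => match Φ.label v with
    | .const c => if u = S.start v then .inl c else .inl 0
    | .var x => if u = S.start v then .inr x else .inl 0
    | .add l r => .inl ((if u = some l then 1 else 0) + (if u = some r then 1 else 0))
    | .mul _ _ => .inl (if u = some (S.closed v) then 1 else 0)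

/-- The rank function of the linear system of a circuit, which includes the source. -/
noncomputable def systemRank (u : Option Φ.Gate) : ℕ := u.elim 0 fun u => S.rank u + 1

/-- Leaves refer to their start, sums to both children, and products to the closed child only; the
other factor of a product enters as the start of the closed child. -/
theorem systemRank_lt {v u : Option Φ.Gate} (h : S.system v u ≠ .inl 0) :
    S.systemRank u < S.systemRank v := by
  classical
  have hstart : ∀ v : Φ.Gate, S.systemRank (S.start v) < S.systemRank (some v) := by
    intro v
    cases hs : S.start v with
    | none => exact Nat.succ_pos _
    | some w => exact Nat.succ_lt_succ (S.rank_start_lt hs)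
  cases v with
  | none => exact absurd rfl h
  | some v =>
    simp only [system] at h
    cases hv : Φ.label v with
    | const c =>
      simp only [hv] at h
      split_ifs at h with hu
      · exact hu ▸ hstart v
      · exact absurd rfl h
    | var x =>
      simp only [hv] at h
      split_ifs at h with hu
      · exact hu ▸ hstart v
      · exact absurd rfl h
    | add l r =>
      simp only [hv] at h
      have hne : ∀ u, ∀ l' r', Φ.label v = .mul l' r' → u ≠ S.closed v := by simp [hv]
      by_cases hl : u = some l
      · rw [hl]
        exact Nat.succ_lt_succ (S.rank_lt_of_isChild ⟨false, by rw [hv]; rfl⟩ (hne l))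
      · by_cases hr : u = some r
        · rw [hr]
          exact Nat.succ_lt_succ (S.rank_lt_of_isChild ⟨true, by rw [hv]; rfl⟩ (hne r))
        · simp [hl, hr] at h
    | mul l r =>
      simp only [hv] at h
      by_cases hu : u = some (S.closed v)
      · rw [hu]
        exact Nat.succ_lt_succ (S.rank_closed_lt hv)
      · simp [hu] at h

/-- The polynomial at a gate, from a solution of the linear system of the circuit. -/
theorem eq_start_mul_value [Fintype Φ.Gate] (p : Option Φ.Gate → MvPolynomial σ F)
    (hp : ∀ v : Φ.Gate, p (some v) = ∑ u, Sum.elim C X (S.system (some v) u) * p u) (v : Φ.Gate) :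
    p (some v) = p (S.start v) * Φ.value v := by
  classical
  induction hn : S.rank v using Nat.strong_induction_on generalizing v with
  | _ n ih =>
    subst hn
    rw [hp, value_eq]
    simp only [system]
    cases hv : Φ.label v with
    | const c =>
      simp only
      rw [Finset.sum_eq_single (S.start v)]
      · simp [mul_comm]
      · intro u _ hu; simp [hu]
      · simp
    | var x =>
      simp only
      rw [Finset.sum_eq_single (S.start v)]
      · simp [mul_comm]
      · intro u _ hu; simp [hu]
      · simp
    | add l r =>
      have hne : ∀ u, ∀ l' r', Φ.label v = .mul l' r' → u ≠ S.closed v := by simp [hv]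
      have hl : IsChild Φ.label l v := ⟨false, by rw [hv]; rfl⟩
      have hr : IsChild Φ.label r v := ⟨true, by rw [hv]; rfl⟩
      simp only [Sum.elim_inl, map_add, add_mul, Finset.sum_add_distrib]
      rw [Finset.sum_eq_single (some l), Finset.sum_eq_single (some r),
        ih _ (S.rank_lt_of_isChild hl (hne l)) l rfl, ih _ (S.rank_lt_of_isChild hr (hne r)) r rfl,
        S.start_congr (S.blocks_of_isChild hl (hne l)),
        S.start_congr (S.blocks_of_isChild hr (hne r))]
      · simp [mul_add]
      · intro u _ hu; simp [hu]
      · simp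
      · intro u _ hu; simp [hu]
      · simp
    | mul l r =>
      simp only [Sum.elim_inl]
      have ho : S.rank (S.other v) < S.rank v := by
        refine S.rank_lt_of_isChild (S.isChild_other hv) fun l' r' _ heq => ?_
        refine Set.disjoint_left.mp (S.disjoint v l r hv) (Φ.mem_subcircuit_self _) ?_
        rw [heq]
        exact Φ.mem_subcircuit_self _
      -- The unknown of the closed child is its value times the unknown of the other child, and the
      -- latter is the value of the other child times the unknown at the start of `v`.
      rw [Finset.sum_eq_single (some (S.closed v)), ih _ (S.rank_closed_lt hv) _ rfl,
        S.start_closed hv, ih _ ho _ rfl, S.start_congr (S.blocks_other hv)]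
      · rcases S.children v l r hv with ⟨h₁, h₂⟩ | ⟨h₁, h₂⟩ <;> rw [h₁, h₂] <;> simp <;> ring
      · intro u _ hu; simp [hu]
      · simp

/-- The matrix of the system minus the identity is triangular with diagonal entries -1, so its
determinant is a sign. Solving with right side -1 at the source makes the source unknown 1 and the
output unknown the value of the circuit; Cramer's rule gives the latter as a determinant. -/
theorem isProjection_DET (S : Φ.Splitting) {o : Φ.Gate} (ho : ∀ u, u ∈ Φ.subcircuit o) :
    IsProjection (Φ.value o) ((DET F).poly (Nat.card Φ.Gate + 1)) := by
  classical
  have := Φ.finite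
  have : Fintype Φ.Gate := Fintype.ofFinite _
  have hcard : Nat.card Φ.Gate + 1 = Fintype.card (Option Φ.Gate) := by simp
  rw [hcard]
  let N : Matrix (Option Φ.Gate) (Option Φ.Gate) (MvPolynomial σ F) :=
    Matrix.of (fun i j => Sum.elim C X (S.system i j)) - 1
  let c : F := (-1) ^ Fintype.card (Option Φ.Gate)
  have hc : c * c = 1 := by rw [← pow_add, ← two_mul, pow_mul]; simp
  have hdiag : ∀ i, S.system i i = .inl 0 := fun i => by
    by_contra hi
    exact (S.systemRank_lt hi).false
  have hdet : N.det = C c := by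
    rw [det_eq_prod_of_rank N S.systemRank]
    · simp [N, hdiag, c]
    · intro i j hij hN
      apply S.systemRank_lt
      intro h
      apply hN
      simp [N, h, hij]
  let b : Option Φ.Gate → MvPolynomial σ F := Pi.single none (-1)
  let p : Option Φ.Gate → MvPolynomial σ F := (C c : MvPolynomial σ F) • N.cramer b
  have hNp : N.mulVec p = b := by
    rw [Matrix.mulVec_smul, Matrix.mulVec_cramer, hdet, smul_smul, ← C_mul, hc, C_1, one_smul]
  have hrow : ∀ i, ∑ u, Sum.elim C X (S.system i u) * p u - p i = b i := by
    intro i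
    rw [← hNp]
    simp only [N, Matrix.sub_mulVec, Matrix.one_mulVec, Pi.sub_apply]
    rfl
  have hnone : p none = 1 := by
    have := hrow none
    simp only [system, Sum.elim_inl, map_zero, zero_mul, Finset.sum_const_zero, zero_sub, b,
      Pi.single_eq_same] at this
    exact neg_injective this
  have hval := S.eq_start_mul_value p (fun v => by
    have := hrow (some v)
    simp only [b, Pi.single_apply, reduceCtorEq, if_false] at this
    exact (sub_eq_zero.mp this).symm) o
  rw [S.start_root ho, hnone, one_mul] at hval
  rw [← hval]
  change IsProjection (C c * N.cramer b (some o)) _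
  -- The sign is absorbed into the replaced column, which keeps every entry a constant or a
  -- variable.
  rw [Matrix.cramer_apply, ← Matrix.det_updateCol_smul]
  convert isProjection_DET_of_matrix (F := F) (σ := σ) (fun i j : Option Φ.Gate =>
    if j = some o then (if i = none then .inl (-c) else .inl 0) else
      if i = j then .inl (-1) else S.system i j) using 2
  refine Matrix.ext fun i j => ?_
  rw [Matrix.updateCol_apply, Matrix.of_apply]
  split_ifs with h₁ h₂ h₂
  · simp [b, h₂]
  · simp [b, h₂]
  · subst h₂; simp [N, hdiag]
  · simp [N, h₂]

end Circuit.Splitting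

/-- A polynomial computed by a weakly skew circuit is a projection of a small determinant. -/
theorem Circuit.WeaklySkew.exists_isProjection_DET {F σ : Type*} [Field F] {Φ : Circuit F σ}
    (h : Φ.WeaklySkew) {f : MvPolynomial σ F} (hf : Φ.Computes f) :
    ∃ N ≤ 2 * Φ.size + 2, IsProjection f ((DET F).poly N) := by
  obtain ⟨o, rfl⟩ := hf
  obtain ⟨S⟩ := ((Φ.pruneEmbedding o).weaklySkew h).exists_splitting
  refine ⟨_, Nat.succ_le_succ (Φ.card_prune_le o), ?_⟩
  rw [← Φ.prune_value o]
  exact S.isProjection_DET (Φ.prune_rooted o)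

end Valiant

namespace Valiant

/-! ### Permanents and multilinear coefficients -/

section multilinearCoeff

open MvPolynomial

variable {R : Type*} [CommRing R]

/-- The coefficient of the product of all variables. -/
noncomputable def multilinearCoeff (σ R : Type*) [Finite σ] [CommRing R] :
    MvPolynomial σ R →ₗ[R] R :=
  lcoeff R (Finsupp.equivFunOnFinite.symm fun _ => 1)

theorem multilinearCoeff_apply {σ : Type*} [Finite σ] (p : MvPolynomial σ R) :
    multilinearCoeff σ R p = coeff (Finsupp.equivFunOnFinite.symm fun _ => 1) p := rfl

open Classical in
theorem multilinearCoeff_prod_X {σ ι : Type*} [Finite σ] [Fintype ι] (φ : ι → σ) :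
    multilinearCoeff σ R (∏ i, X (φ i)) = if Function.Bijective φ then 1 else 0 := by
  have h : (∏ i, X (φ i) : MvPolynomial σ R) = monomial (∑ i, Finsupp.single (φ i) 1) 1 := by
    rw [monomial_sum_one]
    rfl
  rw [h, multilinearCoeff_apply, coeff_monomial]
  congr 1
  rw [Function.bijective_iff_existsUnique, Finsupp.ext_iff, eq_iff_iff]
  refine forall_congr' fun k => ?_
  rw [Finsupp.finsetSum_apply, Finsupp.equivFunOnFinite_symm_apply_apply]
  simp only [Finsupp.single_apply]
  rw [Finset.sum_boole, Nat.cast_id, Finset.card_eq_one]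
  constructor
  · rintro ⟨i, hi⟩
    refine ⟨i, ?_, fun j hj => ?_⟩
    · have : i ∈ Finset.univ.filter fun x => φ x = k := hi ▸ Finset.mem_singleton_self i
      exact (Finset.mem_filter.mp this).2
    · have : j ∈ Finset.univ.filter fun x => φ x = k :=
        Finset.mem_filter.mpr ⟨Finset.mem_univ _, hj⟩
      rw [hi] at this
      exact Finset.mem_singleton.mp this
  · rintro ⟨i, hi, hu⟩
    refine ⟨i, Finset.ext fun j => ?_⟩
    rw [Finset.mem_filter, Finset.mem_singleton]
    exact ⟨fun hj => hu j hj.2, fun hj => ⟨Finset.mem_univ _, hj ▸ hi⟩⟩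

/-- The permanent is the multilinear coefficient of the product of the linear forms given by the
rows. -/
theorem multilinearCoeff_prod_linear {σ ι : Type*} [Fintype σ] [Fintype ι] [DecidableEq ι]
    (e : ι ≃ σ) (L : ι → σ → R) :
    multilinearCoeff σ R (∏ i, ∑ k, C (L i k) * X k) =
      Matrix.permanent (Matrix.of fun i j => L i (e j)) := by
  classical
  rw [Fintype.prod_sum, map_sum]
  have h : ∀ φ : ι → σ, multilinearCoeff σ R (∏ i, C (L i (φ i)) * X (φ i)) =
      if Function.Bijective φ then ∏ i, L i (φ i) else 0 := fun φ => by
    rw [Finset.prod_mul_distrib, ← map_prod, C_mul', map_smul, multilinearCoeff_prod_X]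
    simp
  simp only [h]
  rw [← Finset.sum_filter, Matrix.permanent]
  refine (Finset.sum_bij (fun π _ => e ∘ (π⁻¹ : Equiv.Perm ι)) ?_ ?_ ?_ ?_).symm
  · intro π _
    exact Finset.mem_filter.mpr ⟨Finset.mem_univ _, e.bijective.comp (π⁻¹).bijective⟩
  · intro π _ τ _ hπ
    refine inv_injective (Equiv.ext fun i => e.injective (congrFun hπ i))
  · intro φ hφ
    let E := Equiv.ofBijective φ (Finset.mem_filter.mp hφ).2
    refine ⟨(E.trans e.symm)⁻¹, Finset.mem_univ _, ?_⟩
    ext i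
    simp [E]
  · intro π _
    refine Eq.trans ?_ (Equiv.prod_comp π fun i => L i ((e ∘ (π⁻¹ : Equiv.Perm ι)) i))
    simp

/-- The factors use disjoint sets of variables, so the product of all variables can only arise from
the product of all variables of each factor. -/
theorem multilinearCoeff_prod_rename {G V : Type*} [Fintype G] [Finite V]
    (P : G → MvPolynomial V R) :
    multilinearCoeff (G × V) R (∏ g, rename (Prod.mk g) (P g)) = ∏ g, multilinearCoeff V R (P g) := by
  classical
  have h : ∀ g, rename (Prod.mk g) (P g) =
      ∑ m ∈ (P g).support, monomial (m.mapDomain (Prod.mk g)) (coeff m (P g)) := fun g => by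
    conv_lhs => rw [(P g).as_sum, map_sum]
    exact Finset.sum_congr rfl fun m _ => rename_monomial _ _ _
  have h1 : ∀ g, multilinearCoeff V R (P g) = ∑ m ∈ (P g).support,
      if m = Finsupp.equivFunOnFinite.symm (fun _ => 1) then coeff m (P g) else 0 := fun g => by
    rw [Finset.sum_ite_eq' , multilinearCoeff_apply]
    split_ifs with hm
    · rfl
    · exact notMem_support_iff.mp hm
  simp only [h, h1]
  rw [Finset.prod_univ_sum, Finset.prod_univ_sum, map_sum]
  refine Finset.sum_congr rfl fun m _ => ?_
  have hprod : ∏ g, monomial ((m g).mapDomain (Prod.mk g)) (coeff (m g) (P g)) =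
      C (∏ g, coeff (m g) (P g)) * monomial (∑ g, (m g).mapDomain (Prod.mk g)) 1 := by
    rw [monomial_sum_one, map_prod, ← Finset.prod_mul_distrib]
    exact Finset.prod_congr rfl fun g _ => by rw [C_mul_monomial, mul_one]
  have hval : ∀ g k, (∑ g, (m g).mapDomain (Prod.mk g)) (g, k) = m g k := fun g k => by
    rw [Finsupp.finsetSum_apply, Finset.sum_eq_single g]
    · exact Finsupp.mapDomain_apply (Prod.mk_right_injective g) _ _
    · rintro g' - hg'
      refine Finsupp.mapDomain_of_notMem_range _ _ ?_
      rintro ⟨k', hk'⟩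
      exact hg' (Prod.mk.inj hk').1
    · simp
  rw [hprod, C_mul', map_smul, multilinearCoeff_apply, coeff_monomial, Finset.prod_ite_zero]
  have hiff : (∑ g, (m g).mapDomain (Prod.mk g) = Finsupp.equivFunOnFinite.symm fun _ => 1) ↔
      ∀ g ∈ Finset.univ, m g = Finsupp.equivFunOnFinite.symm fun _ => 1 := by
    simp only [Finsupp.ext_iff, Prod.forall, hval, Finset.mem_univ, true_imp_iff]
    rfl
  rw [if_congr hiff rfl rfl]
  split_ifs <;> simp

theorem sumAlgEquiv_monomial {S₁ S₂ : Type*} (u : S₁ ⊕ S₂ →₀ ℕ) (a : R) :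
    sumAlgEquiv R S₁ S₂ (monomial u a) =
      monomial (u.comapDomain Sum.inl Sum.inl_injective.injOn)
        (monomial (u.comapDomain Sum.inr Sum.inr_injective.injOn) a) := by
  simp [sumAlgEquiv, monomial]

/-- This permits eliminating the private variables of the gadgets before the variables that the
gadgets share. -/
theorem multilinearCoeff_sum {S₁ S₂ : Type*} [Finite S₁] [Finite S₂]
    (p : MvPolynomial (S₁ ⊕ S₂) R) :
    multilinearCoeff (S₁ ⊕ S₂) R p = multilinearCoeff S₂ R
      (multilinearCoeff S₁ (MvPolynomial S₂ R) (sumAlgEquiv R S₁ S₂ p)) := by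
  classical
  induction p using MvPolynomial.induction_on' with
  | monomial u a =>
    rw [sumAlgEquiv_monomial]
    simp only [multilinearCoeff_apply, coeff_monomial]
    have : (u = Finsupp.equivFunOnFinite.symm fun _ => 1) ↔
        (u.comapDomain Sum.inl Sum.inl_injective.injOn = Finsupp.equivFunOnFinite.symm fun _ => 1) ∧
        (u.comapDomain Sum.inr Sum.inr_injective.injOn = Finsupp.equivFunOnFinite.symm fun _ => 1) := by
      simp [Finsupp.ext_iff]
    rw [if_congr this rfl rfl]
    split_ifs <;> simp_all [coeff_monomial]
  | add p q hp hq => simp only [map_add, hp, hq]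

/-- A gadget that replaces the quadratic form `a * b + c * d` by five linear factors, at the cost of
three auxiliary variables. This is one of the places where 2 must be invertible. -/
theorem multilinearCoeff_gadget {S : Type*} [CommRing S] (h : S) (hh : 2 * h = 1)
    (a b c d : S) :
    multilinearCoeff (Fin 3) S ((C a + X 0) * (C b - 2 * X 1) * (C c + X 2 - X 0 - X 1) *
      (C d + X 2 - X 0 - X 1) * (- C h * (X 0 + X 1 + X 2))) = a * b + c * d := by
  -- All exponents are 1, so the coefficient is the mixed third derivative at 0 without any
  -- factorials.
  have key : ∀ p : MvPolynomial (Fin 3) S,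
      multilinearCoeff (Fin 3) S p = constantCoeff (pderiv 0 (pderiv 1 (pderiv 2 p))) := by
    intro p
    rw [constantCoeff_eq, coeff_pderiv, coeff_pderiv, coeff_pderiv, multilinearCoeff_apply]
    have : (Finsupp.equivFunOnFinite.symm fun _ => 1 : Fin 3 →₀ ℕ) =
        0 + Finsupp.single 0 1 + Finsupp.single 1 1 + Finsupp.single 2 1 := by
      ext i
      fin_cases i <;> simp
    rw [this]
    simp
  rw [key]
  have h2 : ∀ i : Fin 3, pderiv i (2 : MvPolynomial (Fin 3) S) = 0 := fun i => by
    have : (2 : MvPolynomial (Fin 3) S) = C 2 := (map_ofNat C 2).symm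
    rw [this, pderiv_C]
  simp only [pderiv_mul, map_add, map_sub, map_neg, map_mul, pderiv_C, pderiv_X, h2, constantCoeff_C,
    constantCoeff_X, Pi.single_apply]
  simp [map_ofNat]
  linear_combination (a * b + c * d) * hh

end multilinearCoeff

end Valiant

namespace Valiant

/-! ### Sums over bits as multilinear coefficients. -/

section selection

variable {N : ℕ} {I : Type*}

/-- The variables `y j`, `y (i, j)` and `z (i, j)`, in this order. -/
abbrev SelectionVar (N : ℕ) (I : Type*) : Type _ :=
  Fin (N + 1) ⊕ ((I × Fin (N + 1)) ⊕ (I × Fin (N + 1)))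

/-- The variables chosen from the factors of the selection polynomial. -/
def selectionMap (o : Fin (N + 1) → Option I) (s : I × Fin (N + 1) → Fin 3) :
    SelectionVar N I → SelectionVar N I
  | .inl j => (o j).elim (.inl j) fun i => .inr (.inl (i, j))
  | .inr (.inl g) => if s g = 2 then .inl g.2 else .inr (.inl g)
  | .inr (.inr g) => if s g = 0 then .inr (.inr g) else .inr (.inr (g.1, g.2 + 1))

/-- The choices in the factors for the pairs that fit to a choice of bits. -/
def selectionPattern [DecidableEq I] (o : Fin (N + 1) → Option I) (e : I → Bool) :
    I × Fin (N + 1) → Fin 3 :=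
  fun g => if e g.1 then (if o g.2 = some g.1 then 2 else 1) else 0

theorem selectionMap_bijective [DecidableEq I] [Finite I] {o : Fin (N + 1) → Option I}
    {e : I → Bool} (h : ∀ j i, o j = some i → e i = true) :
    Function.Bijective (selectionMap o (selectionPattern o e)) := by
  refine Function.Surjective.bijective_of_finite ?_
  rintro (j | ⟨i, j⟩ | ⟨i, j⟩)
  · cases hj : o j with
    | none => exact ⟨.inl j, by simp [selectionMap, hj]⟩
    | some i => exact ⟨.inr (.inl (i, j)), by simp [selectionMap, selectionPattern, hj, h j i hj]⟩
  · by_cases hj : o j = some i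
    · exact ⟨.inl j, by simp [selectionMap, hj]⟩
    · refine ⟨.inr (.inl (i, j)), ?_⟩
      cases he : e i <;> simp [selectionMap, selectionPattern, hj, he]
  · cases he : e i with
    | false => exact ⟨.inr (.inr (i, j)), by simp [selectionMap, selectionPattern, he]⟩
    | true =>
      refine ⟨.inr (.inr (i, j - 1)), ?_⟩
      have : selectionPattern o e (i, j - 1) ≠ 0 := by
        simp only [selectionPattern, he, if_true]
        split_ifs <;> decide
      simp [selectionMap, this]

/-- For fixed `i`, the variables `z (i, j)` lie on a cycle in `j`. Using each only once means that
all factors keep their own one or all shift to the next; this common decision is the bit at `i`. If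
row `j` has taken `y (i, j)`, the factor at `(i, j)` must take `y j`, which is possible only after a
shift. -/
theorem exists_of_selectionMap_injective [DecidableEq I] {o : Fin (N + 1) → Option I}
    {s : I × Fin (N + 1) → Fin 3} (h : Function.Injective (selectionMap o s)) :
    ∃ e : I → Bool, (∀ j i, o j = some i → e i = true) ∧ s = selectionPattern o e := by
  have hstep : ∀ i j, s (i, j) ≠ 0 → s (i, j + 1) ≠ 0 := by
    intro i j hj hj'
    have : selectionMap o s (.inr (.inr (i, j))) = selectionMap o s (.inr (.inr (i, j + 1))) := by
      simp [selectionMap, hj, hj']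
    have : j = j + 1 := congrArg Prod.snd (Sum.inr.inj (Sum.inr.inj (h this)))
    rw [← this] at hj'
    exact hj hj'
  have hup : ∀ i, s (i, 0) ≠ 0 → ∀ j, s (i, j) ≠ 0 := by
    intro i h0 j
    induction j using Fin.induction with
    | zero => exact h0
    | succ j ih => rw [← Fin.coeSucc_eq_succ]; exact hstep _ _ ih
  have hdown : ∀ i j, s (i, j) ≠ 0 → s (i, 0) ≠ 0 := by
    intro i j hj
    have hlast : s (i, Fin.last N) ≠ 0 := by
      induction j using Fin.reverseInduction with
      | last => exact hj
      | cast j ih => exact ih (by rw [← Fin.coeSucc_eq_succ]; exact hstep _ _ hj)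
    -- Addition in `Fin (N + 1)` wraps around from the last index to 0.
    have := hstep i _ hlast
    rwa [Fin.last_add_one] at this
  have hsome : ∀ j i, o j = some i → s (i, j) = 2 := by
    intro j i hj
    by_contra hs
    have : selectionMap o s (.inl j) = selectionMap o s (.inr (.inl (i, j))) := by
      simp [selectionMap, hj, hs]
    exact Sum.inl_ne_inr (h this)
  have htwo : ∀ j i, s (i, j) = 2 → o j = some i := by
    intro j i hs
    cases hj : o j with
    | none =>
      have : selectionMap o s (.inl j) = selectionMap o s (.inr (.inl (i, j))) := by
        simp [selectionMap, hj, hs]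
      exact absurd (h this) Sum.inl_ne_inr
    | some i' =>
      have : selectionMap o s (.inr (.inl (i', j))) = selectionMap o s (.inr (.inl (i, j))) := by
        simp [selectionMap, hsome j i' hj, hs]
      rw [(Prod.mk.inj (Sum.inl.inj (Sum.inr.inj (h this)))).1]
  refine ⟨fun i => decide (s (i, 0) ≠ 0), fun j i hj => ?_, funext fun ⟨i, j⟩ => ?_⟩
  · have := hdown i j (by rw [hsome j i hj]; decide)
    simpa using this
  · simp only [selectionPattern, decide_eq_true_eq]
    split_ifs with h0 ho
    · exact hsome j i ho
    · have h₁ := hup i h0 j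
      have h₂ : s (i, j) ≠ 2 := fun h₂ => ho (htwo j i h₂)
      generalize s (i, j) = x at h₁ h₂
      revert x
      decide
    · by_contra h₁
      exact h0 (hdown i j h₁)

theorem selectionPattern_injective [DecidableEq I] (o : Fin (N + 1) → Option I) :
    Function.Injective (selectionPattern o) := by
  have key : ∀ e e' : I → Bool, selectionPattern o e = selectionPattern o e' →
      ∀ i, e i = true → e' i = true := by
    intro e e' h i he
    by_contra he'
    have := congrFun h (i, 0)
    simp only [selectionPattern, he, he', if_true] at this
    revert this
    split_ifs <;> simp_all
  exact fun e e' h => funext fun i => Bool.eq_iff_iff.mpr ⟨key _ _ h i, key _ _ h.symm i⟩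

open MvPolynomial

/-- The linear factors of the selection polynomial. -/
noncomputable def selectionRow {R : Type*} [CommRing R] [Fintype I] (c : Fin (N + 1) → R)
    (a : Fin (N + 1) → I → R) (j : Fin (N + 1)) : MvPolynomial (SelectionVar N I) R :=
  C (c j) * X (Sum.inl j : SelectionVar N I) +
    ∑ i, C (a j i) * X (Sum.inr (Sum.inl (i, j)) : SelectionVar N I)

/-- The quadratic factors of the selection polynomial. -/
noncomputable def selectionPair (R : Type*) [CommRing R] (g : I × Fin (N + 1)) :
    MvPolynomial (SelectionVar N I) R :=
  X (Sum.inr (Sum.inr g) : SelectionVar N I) * X (Sum.inr (Sum.inl g) : SelectionVar N I) +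
    X (Sum.inr (Sum.inr (g.1, g.2 + 1)) : SelectionVar N I) *
      (X (Sum.inr (Sum.inl g) : SelectionVar N I) + X (Sum.inl g.2 : SelectionVar N I))

variable {R : Type*} [CommRing R]

theorem selectionRow_eq [Fintype I] (c : Fin (N + 1) → R) (a : Fin (N + 1) → I → R)
    (j : Fin (N + 1)) : selectionRow c a j = ∑ o : Option I, C (o.elim (c j) (a j)) *
      X (o.elim (Sum.inl j) fun i => Sum.inr (Sum.inl (i, j)) : SelectionVar N I) := by
  rw [Fintype.sum_option]; rfl

theorem selectionPair_eq (g : I × Fin (N + 1)) : selectionPair R g = ∑ s : Fin 3,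
    X (if s = 2 then Sum.inl g.2 else Sum.inr (Sum.inl g) : SelectionVar N I) *
      X (if s = 0 then Sum.inr (Sum.inr g) else Sum.inr (Sum.inr (g.1, g.2 + 1)) :
        SelectionVar N I) := by
  rw [Fin.sum_univ_three, selectionPair]
  simp
  ring

open Classical in
-- Expanding all factors leaves the choices that use every variable once. For given choices `o` in
-- the rows, these correspond to the bit vectors that are true at every chosen `i`; exchanging the
-- two sums restores the product of affine forms.
theorem multilinearCoeff_selection [Fintype I]
    (c : Fin (N + 1) → R) (a : Fin (N + 1) → I → R) :
    multilinearCoeff (SelectionVar N I) R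
      ((∏ j, selectionRow c a j) * ∏ g, selectionPair R g) =
      ∑ e : I → Bool, ∏ j, (c j + ∑ i, if e i then a j i else 0) := by
  simp only [selectionRow_eq, selectionPair_eq]
  rw [Fintype.prod_sum, Fintype.prod_sum, Finset.sum_mul_sum, map_sum]
  have h₃ : ∀ (o : Fin (N + 1) → Option I) (s : I × Fin (N + 1) → Fin 3),
      multilinearCoeff (SelectionVar N I) R
      ((∏ j, C ((o j).elim (c j) (a j)) *
        X ((o j).elim (Sum.inl j) fun i => Sum.inr (Sum.inl (i, j)) : SelectionVar N I)) *
      ∏ g, X (if s g = 2 then Sum.inl g.2 else Sum.inr (Sum.inl g) : SelectionVar N I) *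
        X (if s g = 0 then Sum.inr (Sum.inr g) else Sum.inr (Sum.inr (g.1, g.2 + 1)) :
          SelectionVar N I)) =
      if Function.Bijective (selectionMap o s) then ∏ j, (o j).elim (c j) (a j) else 0 := by
    intro o s
    have : (∏ j, C ((o j).elim (c j) (a j)) *
        X ((o j).elim (Sum.inl j) fun i => Sum.inr (Sum.inl (i, j)) : SelectionVar N I)) *
      ∏ g, X (if s g = 2 then Sum.inl g.2 else Sum.inr (Sum.inl g) : SelectionVar N I) *
        X (if s g = 0 then Sum.inr (Sum.inr g) else Sum.inr (Sum.inr (g.1, g.2 + 1)) :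
          SelectionVar N I) =
        C (∏ j, (o j).elim (c j) (a j)) * ∏ k, X (selectionMap o s k) := by
      rw [Fintype.prod_sum_type, Fintype.prod_sum_type, Finset.prod_mul_distrib,
        Finset.prod_mul_distrib, map_prod]
      simp only [selectionMap]
      ring
    rw [this, C_mul', map_smul, multilinearCoeff_prod_X]
    simp
  have h₄ : ∀ o : Fin (N + 1) → Option I, (∑ s,
      if Function.Bijective (selectionMap o s) then ∏ j, (o j).elim (c j) (a j) else 0) =
      ∑ e : I → Bool, if ∀ j i, o j = some i → e i = true then ∏ j, (o j).elim (c j) (a j)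
        else 0 := by
    intro o
    rw [← Finset.sum_filter, ← Finset.sum_filter]
    refine (Finset.sum_bij (fun e _ => selectionPattern o e) ?_ ?_ ?_ fun _ _ => rfl).symm
    · intro e he
      exact Finset.mem_filter.mpr
        ⟨Finset.mem_univ _, selectionMap_bijective (Finset.mem_filter.mp he).2⟩
    · intro e _ e' _ h
      exact selectionPattern_injective o h
    · intro s hs
      obtain ⟨e, he, rfl⟩ := exists_of_selectionMap_injective (Finset.mem_filter.mp hs).2.1
      exact ⟨e, Finset.mem_filter.mpr ⟨Finset.mem_univ _, he⟩, rfl⟩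
  simp only [map_sum, h₃, h₄]
  rw [Finset.sum_comm]
  refine Finset.sum_congr rfl fun e _ => ?_
  have h₅ : ∀ j, c j + ∑ i, (if e i then a j i else 0) =
      ∑ o : Option I, if ∀ i, o = some i → e i = true then o.elim (c j) (a j) else 0 := by
    intro j
    rw [Fintype.sum_option]
    simp
  simp only [h₅]
  rw [Fintype.prod_sum]
  refine Finset.sum_congr rfl fun o _ => ?_
  rw [Finset.prod_ite_zero]
  simp

end selection

end Valiant

namespace Valiant

open MvPolynomial

/-! ### Sums over bits as permanents. -/

section linearForms

variable {F R : Type*} [Field F] [CommRing R] [Algebra F R]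

/-- The linear forms with coefficients in a given set. -/
def linearForms (κ : Type*) [Fintype κ] (A : Submodule F R) : Submodule F (MvPolynomial κ R) where
  carrier := {p | ∃ L : κ → R, (∀ k, L k ∈ A) ∧ p = ∑ k, C (L k) * X k}
  zero_mem' := ⟨0, fun _ => A.zero_mem, by simp⟩
  add_mem' := by
    rintro _ _ ⟨L, hL, rfl⟩ ⟨M, hM, rfl⟩
    refine ⟨L + M, fun k => A.add_mem (hL k) (hM k), ?_⟩
    simp [add_mul, Finset.sum_add_distrib]
  smul_mem' := by
    rintro c _ ⟨L, hL, rfl⟩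
    refine ⟨c • L, fun k => A.smul_mem c (hL k), ?_⟩
    rw [Finset.smul_sum]
    refine Finset.sum_congr rfl fun k _ => ?_
    rw [C_mul', C_mul', Pi.smul_apply, smul_assoc]

theorem C_mul_X_mem_linearForms {κ : Type*} [Fintype κ] {A : Submodule F R} {a : R} (ha : a ∈ A)
    (k : κ) : C a * X k ∈ linearForms κ A := by
  classical
  refine ⟨Pi.single k a, fun l => ?_, ?_⟩
  · rw [Pi.single_apply]
    split_ifs
    · exact ha
    · exact A.zero_mem
  · rw [Finset.sum_eq_single k]
    · simp
    · intro l _ hl; simp [hl]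
    · simp

theorem X_mem_linearForms {κ : Type*} [Fintype κ] {A : Submodule F R} (h1 : (1 : R) ∈ A) (k : κ) :
    (X k : MvPolynomial κ R) ∈ linearForms κ A := by
  simpa using C_mul_X_mem_linearForms h1 k

/-- The multilinear coefficient of a product of linear forms is a permanent. -/
theorem exists_permanent_eq {κ ι : Type*} [Fintype κ] [Fintype ι] {A : Submodule F R} {n : ℕ}
    (hι : Fintype.card ι = n) (hκ : Fintype.card κ = n) (P : ι → MvPolynomial κ R)
    (hP : ∀ i, P i ∈ linearForms κ A) :
    ∃ B : Matrix (Fin n) (Fin n) R, (∀ i j, B i j ∈ A) ∧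
      B.permanent = multilinearCoeff κ R (∏ i, P i) := by
  choose L hL hP using hP
  let e : Fin n ≃ ι := (Fintype.equivFinOfCardEq hι).symm
  let e' : Fin n ≃ κ := (Fintype.equivFinOfCardEq hκ).symm
  refine ⟨Matrix.of fun i j => L (e i) (e' j), fun i j => hL _ _, ?_⟩
  rw [← multilinearCoeff_prod_linear e' fun i k => L (e i) k, ← Equiv.prod_comp e]
  simp only [← hP]

end linearForms

section gadgets

variable {F R : Type*} [Field F] [CommRing R] [Algebra F R] {N : ℕ} {I : Type*}

/-- The columns of the matrix whose permanent is a sum over bits: three for each gadget, and the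
variables of the selection polynomial. -/
abbrev GadgetColumn (N : ℕ) (I : Type*) : Type _ := ((I × Fin (N + 1)) × Fin 3) ⊕ SelectionVar N I

/-- The rows of the gadget that represents a quadratic factor of the selection polynomial. -/
noncomputable def gadgetRow (F R : Type*) [Field F] [CommRing R] [Algebra F R]
    (g : I × Fin (N + 1)) : Fin 5 → MvPolynomial (GadgetColumn N I) R :=
  let x : Fin 3 → MvPolynomial (GadgetColumn N I) R := fun t => X (Sum.inl (g, t))
  let y : SelectionVar N I → MvPolynomial (GadgetColumn N I) R := fun k => X (Sum.inr k)
  ![y (.inr (.inr g)) + x 0, y (.inr (.inl g)) - (2 : F) • x 1,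
    y (.inr (.inr (g.1, g.2 + 1))) + x 2 - x 0 - x 1,
    y (.inr (.inl g)) + y (.inl g.2) + x 2 - x 0 - x 1, (-2⁻¹ : F) • (x 0 + x 1 + x 2)]

theorem gadgetRow_mem [Fintype I] {A : Submodule F R} (h1 : (1 : R) ∈ A) (g : I × Fin (N + 1))
    (r : Fin 5) : gadgetRow F R g r ∈ linearForms (GadgetColumn N I) A := by
  have hX := X_mem_linearForms (κ := GadgetColumn N I) h1
  fin_cases r
  · exact add_mem (hX _) (hX _)
  · exact sub_mem (hX _) (Submodule.smul_mem _ _ (hX _))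
  · exact sub_mem (sub_mem (add_mem (hX _) (hX _)) (hX _)) (hX _)
  · exact sub_mem (sub_mem (add_mem (add_mem (hX _) (hX _)) (hX _)) (hX _)) (hX _)
  · exact Submodule.smul_mem _ _ (add_mem (add_mem (hX _) (hX _)) (hX _))

theorem rename_selectionRow_mem [Fintype I] {A : Submodule F R} {c : Fin (N + 1) → R}
    {a : Fin (N + 1) → I → R} (hc : ∀ j, c j ∈ A) (ha : ∀ j i, a j i ∈ A) (j : Fin (N + 1)) :
    rename Sum.inr (selectionRow c a j) ∈ linearForms (GadgetColumn N I) A := by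
  simp only [selectionRow, map_add, map_sum, map_mul, rename_C, rename_X]
  exact add_mem (C_mul_X_mem_linearForms (hc j) _)
    (sum_mem fun i _ => C_mul_X_mem_linearForms (ha j i) _)

/-- The sum of a product of affine forms over all choices of bits is a permanent. -/
theorem exists_permanent_eq_sum (h2 : (2 : F) ≠ 0) {A : Submodule F R} (h1 : (1 : R) ∈ A)
    [Fintype I] [DecidableEq I] {c : Fin (N + 1) → R} {a : Fin (N + 1) → I → R}
    (hc : ∀ j, c j ∈ A) (ha : ∀ j i, a j i ∈ A) {n : ℕ} (hn : n = (N + 1) + 5 * (Fintype.card I * (N + 1))) :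
    ∃ B : Matrix (Fin n) (Fin n) R, (∀ i j, B i j ∈ A) ∧
      B.permanent = ∑ e : I → Bool, ∏ j, (c j + ∑ i, if e i then a j i else 0) := by
  obtain ⟨B, hB, hB'⟩ := exists_permanent_eq (κ := GadgetColumn N I)
    (ι := Fin (N + 1) ⊕ ((I × Fin (N + 1)) × Fin 5)) (A := A) (n := n)
    -- The matrix is square: the five rows of a pair match its three private columns and the
    -- variables `y (i, j)` and `z (i, j)`, and the remaining rows match the `y j`.
    (by simp [hn]; ring) (by simp [hn]; ring)
    (Sum.elim (fun j => rename Sum.inr (selectionRow c a j)) fun g => gadgetRow F R g.1 g.2)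
    (by
      rintro (j | ⟨g, r⟩)
      · exact rename_selectionRow_mem hc ha j
      · exact gadgetRow_mem h1 g r)
  refine ⟨B, hB, hB'.trans ?_⟩
  rw [multilinearCoeff_sum, Fintype.prod_sum_type, map_mul, map_prod, map_prod,
    Fintype.prod_prod_type]
  have hr : ∀ p : MvPolynomial (SelectionVar N I) R,
      sumAlgEquiv R ((I × Fin (N + 1)) × Fin 3) _ (rename Sum.inr p) = C p := fun p =>
    DFunLike.congr_fun (sumAlgEquiv_comp_rename_inr R ((I × Fin (N + 1)) × Fin 3)
      (SelectionVar N I)) p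
  let S := MvPolynomial (SelectionVar N I) R
  let y : SelectionVar N I → S := fun k => X k
  let h : S := C (algebraMap F R 2⁻¹)
  have hh : 2 * h = 1 := by
    have : (2 : S) = C (algebraMap F R 2) := by rw [map_ofNat, map_ofNat]
    rw [this, ← map_mul, ← map_mul, mul_inv_cancel₀ h2, map_one, map_one]
  have hs : ∀ (c : F) (p : MvPolynomial (GadgetColumn N I) R),
      sumAlgEquiv R ((I × Fin (N + 1)) × Fin 3) (SelectionVar N I) (c • p) =
        C (C (algebraMap F R c)) * sumAlgEquiv R _ _ p := fun c p => by
    rw [algebra_compatible_smul R c p, smul_eq_C_mul, map_mul, sumAlgEquiv_C_inl]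
  -- The product of the rows of one gadget, as a polynomial in its three private columns over the
  -- ring of the shared variables.
  let P : I × Fin (N + 1) → MvPolynomial (Fin 3) S := fun g =>
    (C (y (.inr (.inr g))) + X 0) * (C (y (.inr (.inl g))) - 2 * X 1) *
      (C (y (.inr (.inr (g.1, g.2 + 1)))) + X 2 - X 0 - X 1) *
      (C (y (.inr (.inl g)) + y (.inl g.2)) + X 2 - X 0 - X 1) * (- C h * (X 0 + X 1 + X 2))
  have hP : ∀ g, ∏ r, sumAlgEquiv R ((I × Fin (N + 1)) × Fin 3) (SelectionVar N I)
      (gadgetRow F R g r) = rename (Prod.mk g) (P g) := by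
    intro g
    simp only [Fin.prod_univ_five, gadgetRow, P, h, y, Matrix.cons_val, map_add, map_sub, map_mul,
      map_neg, hs, sumAlgEquiv_X_inl, sumAlgEquiv_X_inr, rename_C, rename_X, map_ofNat]
  simp only [Sum.elim_inl, Sum.elim_inr, hr, hP, ← map_prod]
  rw [C_mul', map_smul, multilinearCoeff_prod_rename, smul_eq_mul]
  have hg : ∀ g, multilinearCoeff (Fin 3) S (P g) = selectionPair R g := fun g =>
    multilinearCoeff_gadget h hh _ _ _ _
  refine (congrArg _ (congrArg _ (Finset.prod_congr rfl fun g _ => hg g))).trans ?_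
  convert multilinearCoeff_selection c a

end gadgets

end Valiant

namespace Valiant

namespace Circuit

/-! ### The value of a multiplicatively disjoint circuit as a sum over edge selections -/

variable {F σ : Type*} (Φ : Circuit F σ)

open MvPolynomial

/-- A gate of maximal depth in a nonempty finite set of gates. -/
theorem exists_top {W : Finset Φ.Gate} (hW : W.Nonempty) :
    ∃ v ∈ W, ∀ w ∈ W, ¬ IsChild Φ.label v w := by
  obtain ⟨v, hv, hmax⟩ := W.exists_max_image (fun v => (Φ.subcircuit v).ncard) hW
  exact ⟨v, hv, fun w hw h => (Splitting.ncard_subcircuit_lt h).not_ge (hmax w hw)⟩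

section

variable {S : Type*} [CommRing S]

open Classical in
/-- The number of selected edges from `u` to `v`, where `b` tells which of the edges into `v` are
selected. -/
noncomputable def edgeCount (S : Type*) [CommRing S] (v : Φ.Gate) (b : Bool → Bool) (u : Φ.Gate) :
    S :=
  ∑ s, if (Φ.label v).child s = some u ∧ b s = true then 1 else 0

theorem edgeCount_false (v u : Φ.Gate) : Φ.edgeCount S v (fun _ => false) u = 0 := by
  simp [edgeCount]

theorem edgeCount_eq_zero {v u : Φ.Gate} (h : ¬ IsChild Φ.label u v) (b : Bool → Bool) :
    Φ.edgeCount S v b u = 0 :=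
  Finset.sum_eq_zero fun s _ => if_neg fun hs => h ⟨s, hs.1⟩

open Classical in
/-- The number of selected edges out of `u`, where the gates from `D` count as the sources of an
additional edge. -/
noncomputable def demand (S : Type*) [CommRing S] [Fintype Φ.Gate] (D : Finset Φ.Gate)
    (h : Φ.Gate → Bool → Bool) (u : Φ.Gate) : S :=
  (if u ∈ D then 1 else 0) + ∑ w, Φ.edgeCount S w (h w) u

/-- The weights of the gates, as functions of the demand and of the selected incoming edges, whose
sum over all selections is the value of a multiplicatively disjoint circuit. -/
structure IsGateWeight [CommSemiring F] [Algebra F S] (ρ : σ → S) (K : Φ.Gate → S → (Bool → Bool) → S) : Prop where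
  zero : ∀ v b, K v 0 b = if b = fun _ => false then 1 else 0
  input : ∀ v, (∀ s, (Φ.label v).child s = none) →
    ∀ b, K v 1 b = if b = fun _ => false then aeval ρ (Φ.value v) else 0
  add : ∀ v l r, Φ.label v = .add l r → ∀ b, K v 1 b = if b false ≠ b true then 1 else 0
  mul : ∀ v l r, Φ.label v = .mul l r → ∀ b, K v 1 b = if b = fun _ => true then 1 else 0

end

theorem eq_id_or_eq_not (b : Bool → Bool) (hb : b false ≠ b true) :
    (b = fun s => s) ∨ b = fun s => !s := by
  revert b
  decide

/-- Functions equal to `z` outside `W` stand for functions on `W`; the value at `v` is split off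
without changing the domain. -/
theorem sum_update_eq {V B M : Type*} [Fintype V] [DecidableEq V] [Fintype B] [DecidableEq B]
    [AddCommMonoid M] (z : B) {W : Finset V} {v : V} (hv : v ∈ W) (φ : (V → B) → M) :
    ∑ h with ∀ u ∉ W, h u = z, φ h =
      ∑ b, ∑ h with ∀ u ∉ W.erase v, h u = z, φ (Function.update h v b) := by
  rw [← Finset.sum_product']
  refine Finset.sum_bij' (fun h _ => (h v, Function.update h v z))
    (fun p _ => Function.update p.2 v p.1) ?_ ?_ ?_ ?_ ?_
  · intro h hh
    simp only [Finset.mem_filter, Finset.mem_univ, true_and, Finset.mem_product] at hh ⊢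
    intro u hu
    rcases eq_or_ne u v with rfl | huv
    · simp
    · rw [Function.update_of_ne huv]
      exact hh u fun hW => hu (Finset.mem_erase.mpr ⟨huv, hW⟩)
  · rintro ⟨b, h⟩ hh
    simp only [Finset.mem_filter, Finset.mem_univ, true_and, Finset.mem_product] at hh ⊢
    intro u hu
    have huv : u ≠ v := fun h' => hu (h' ▸ hv)
    rw [Function.update_of_ne huv]
    exact hh u fun hW => hu (Finset.mem_of_mem_erase hW)
  · intro h _
    simp
  · rintro ⟨b, h⟩ hh
    simp only [Finset.mem_filter, Finset.mem_univ, true_and, Finset.mem_product] at hh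
    have : h v = z := hh v (by simp)
    simp [← this]
  · intro h _
    simp

variable [CommSemiring F] {S : Type*} [CommRing S] [Algebra F S] {ρ : σ → S}
  {K : Φ.Gate → S → (Bool → Bool) → S} {Φ}

open Classical in
-- `D` is the set of gates whose values are still to be computed. Removing a topmost gate `v` of `W`
-- replaces it in `D` by the children along the selected edges: one child for a sum, both for a
-- product. Multiplicative disjointness keeps the subcircuits of `D` disjoint, so only the demands 0
-- and 1 matter, which is all that `IsGateWeight` prescribes.
theorem MultiplicativelyDisjoint.sum_prod_eq [Fintype Φ.Gate] (hΦ : Φ.MultiplicativelyDisjoint)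
    (hK : Φ.IsGateWeight ρ K) (W D : Finset Φ.Gate)
    (hW : ∀ v ∈ W, ∀ s u, (Φ.label v).child s = some u → u ∈ W) (hDW : D ⊆ W)
    (hD : (D : Set Φ.Gate).PairwiseDisjoint Φ.subcircuit) :
    ∑ h : Φ.Gate → Bool → Bool with ∀ v ∉ W, h v = fun _ => false,
      ∏ v ∈ W, K v (Φ.demand S D h v) (h v) = ∏ u ∈ D, aeval ρ (Φ.value u) := by
  induction hn : W.card generalizing W D with
  | zero =>
    obtain rfl := Finset.card_eq_zero.mp hn
    obtain rfl := Finset.subset_empty.mp hDW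
    have : (Finset.univ.filter fun h : Φ.Gate → Bool → Bool =>
        ∀ v ∉ (∅ : Finset Φ.Gate), h v = fun _ => false) = {fun _ _ => false} := by
      ext h
      simp only [Finset.notMem_empty, not_false_eq_true, true_imp_iff, Finset.mem_filter,
        Finset.mem_univ, true_and, Finset.mem_singleton]
      exact funext_iff.symm
    rw [this]
    simp
  | succ n ih =>
    obtain ⟨v, hv, htop⟩ := Φ.exists_top (W := W) (Finset.card_pos.mp (by omega))
    have hcard : (W.erase v).card = n := by rw [Finset.card_erase_of_mem hv]; omega
    have hW' : ∀ w ∈ W.erase v, ∀ s u, (Φ.label w).child s = some u → u ∈ W.erase v := by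
      intro w hw s u hu
      have hw' := Finset.mem_of_mem_erase hw
      refine Finset.mem_erase.mpr ⟨?_, hW w hw' s u hu⟩
      rintro rfl
      exact htop w hw' ⟨s, hu⟩
    rw [sum_update_eq _ hv]
    -- No gate of `W` has `v` as a child, and gates outside `W` select no edges.
    have hdemand : ∀ (b : Bool → Bool) (h : Φ.Gate → Bool → Bool),
        (∀ u ∉ W.erase v, h u = fun _ => false) →
        Φ.demand S D (Function.update h v b) v = if v ∈ D then 1 else 0 := by
      intro b h hh'
      rw [demand, Finset.sum_eq_zero, add_zero]
      intro w _
      by_cases hw : w ∈ W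
      · exact Φ.edgeCount_eq_zero (htop w hw) _
      · have : w ≠ v := fun h' => hw (h' ▸ hv)
        rw [Function.update_of_ne this, hh' w fun h' => hw (Finset.mem_of_mem_erase h')]
        exact Φ.edgeCount_false _ _
    have hstep : ∀ (b : Bool → Bool) (D' : Finset Φ.Gate), D' ⊆ W.erase v →
        (D' : Set Φ.Gate).PairwiseDisjoint Φ.subcircuit →
        (∀ u ≠ v, (if u ∈ D' then 1 else 0 : S) = (if u ∈ D then 1 else 0) + Φ.edgeCount S v b u) →
        ∑ h : Φ.Gate → Bool → Bool with ∀ u ∉ W.erase v, h u = fun _ => false,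
          ∏ u ∈ W, K u (Φ.demand S D (Function.update h v b) u) (Function.update h v b u) =
        K v (if v ∈ D then 1 else 0) b * ∏ u ∈ D', aeval ρ (Φ.value u) := by
      intro b D' hD'W hD' hind
      rw [← ih (W.erase v) D' hW' hD'W hD' hcard, Finset.mul_sum]
      refine Finset.sum_congr rfl fun h hh => ?_
      have hh' := (Finset.mem_filter.mp hh).2
      rw [← Finset.mul_prod_erase W _ hv, Function.update_self]
      rw [hdemand b h hh']
      congr 1
      refine Finset.prod_congr rfl fun u hu => ?_
      have huv : u ≠ v := Finset.ne_of_mem_erase hu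
      rw [Function.update_of_ne huv]
      congr 1
      rw [demand, demand, hind u huv, add_assoc]
      congr 1
      rw [← Finset.add_sum_erase _ _ (Finset.mem_univ v),
        ← Finset.add_sum_erase (a := v) Finset.univ (fun w => Φ.edgeCount S w (h w) u)
          (Finset.mem_univ v), Function.update_self, hh' v (by simp), edgeCount_false, zero_add]
      congr 1
      refine Finset.sum_congr rfl fun w hw => ?_
      rw [Function.update_of_ne (Finset.ne_of_mem_erase hw)]
    have hzero : ∀ b : Bool → Bool, K v (if v ∈ D then 1 else 0) b = 0 →
        ∑ h : Φ.Gate → Bool → Bool with ∀ u ∉ W.erase v, h u = fun _ => false,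
          ∏ u ∈ W, K u (Φ.demand S D (Function.update h v b) u) (Function.update h v b u) = 0 := by
      intro b hb
      refine Finset.sum_eq_zero fun h hh => Finset.prod_eq_zero hv ?_
      rw [Function.update_self, hdemand b h (Finset.mem_filter.mp hh).2, hb]
    by_cases hvD : v ∈ D
    swap
    · rw [Fintype.sum_eq_single (fun _ => false), hstep _ D, if_neg hvD, hK.zero, if_pos rfl,
        one_mul]
      · exact fun u hu => Finset.mem_erase.mpr ⟨fun h => hvD (h ▸ hu), hDW hu⟩
      · exact hD
      · intro u _
        rw [edgeCount_false, add_zero]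
      · intro b hb
        exact hzero b (by rw [if_neg hvD, hK.zero, if_neg hb])
    have hDe : D.erase v ⊆ W.erase v := Finset.erase_subset_erase v hDW
    have hDed : (D.erase v : Set Φ.Gate).PairwiseDisjoint Φ.subcircuit :=
      hD.subset (Finset.coe_subset.mpr (Finset.erase_subset v D))
    have hprod := Finset.mul_prod_erase D (fun u => aeval ρ (Φ.value u)) hvD
    have hdisj : ∀ s u, (Φ.label v).child s = some u → ∀ w ∈ D.erase v,
        Disjoint (Φ.subcircuit u) (Φ.subcircuit w) := fun s u hu w hw =>
      (hD hvD (Finset.mem_of_mem_erase hw) (Finset.ne_of_mem_erase hw).symm).mono_left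
        (Φ.subcircuit_mono (Φ.child_mem_subcircuit hu))
    have hnot : ∀ s u, (Φ.label v).child s = some u → u ∉ D.erase v := fun s u hu hw =>
      Set.disjoint_left.mp (hdisj s u hu u hw) (Φ.mem_subcircuit_self u) (Φ.mem_subcircuit_self u)
    have hmem : ∀ s u, (Φ.label v).child s = some u → u ∈ W.erase v := fun s u hu =>
      Finset.mem_erase.mpr ⟨Φ.child_ne hu, hW v hv s u hu⟩
    have hind : ∀ u ≠ v, (if u ∈ D.erase v then 1 else 0 : S) = if u ∈ D then 1 else 0 := by
      intro u hu
      simp [Finset.mem_erase, hu]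
    have hinsert : ∀ (E : Finset Φ.Gate) (l u : Φ.Gate), l ∉ E →
        (if u ∈ insert l E then 1 else 0 : S) =
          (if u ∈ E then 1 else 0) + if l = u then 1 else 0 := by
      intro E l u hl
      rcases eq_or_ne l u with rfl | h
      · simp [hl]
      · simp [h, h.symm]
    have hinput : (∀ s, (Φ.label v).child s = none) →
        ∑ b, ∑ h : Φ.Gate → Bool → Bool with ∀ u ∉ W.erase v, h u = fun _ => false,
          ∏ u ∈ W, K u (Φ.demand S D (Function.update h v b) u) (Function.update h v b u) =
        ∏ u ∈ D, aeval ρ (Φ.value u) := by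
      intro hlab
      rw [Fintype.sum_eq_single (fun _ => false), hstep _ (D.erase v) hDe hDed, if_pos hvD,
        hK.input v hlab, if_pos rfl, hprod]
      · intro u hu
        rw [edgeCount_false, add_zero, hind u hu]
      · intro b hb
        exact hzero b (by rw [if_pos hvD, hK.input v hlab, if_neg hb])
    have hval := Φ.value_eq v
    match hlab : Φ.label v with
    | .const c => exact hinput fun s => by rw [hlab]; rfl
    | .var x => exact hinput fun s => by rw [hlab]; rfl
    | .add l r =>
      have hl : (Φ.label v).child false = some l := by rw [hlab]; rfl
      have hr : (Φ.label v).child true = some r := by rw [hlab]; rfl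
      have hone : ∀ (b : Bool → Bool) (s : Bool) (u : Φ.Gate), (Φ.label v).child s = some u →
          b s = true → b (!s) = false →
          ∑ h : Φ.Gate → Bool → Bool with ∀ u ∉ W.erase v, h u = fun _ => false,
            ∏ u ∈ W, K u (Φ.demand S D (Function.update h v b) u) (Function.update h v b u) =
          aeval ρ (Φ.value u) * ∏ u ∈ D.erase v, aeval ρ (Φ.value u) := by
        intro b s u hu hb hb'
        rw [hstep b (insert u (D.erase v)), if_pos hvD, hK.add v l r hlab, if_pos, one_mul,
          Finset.prod_insert (hnot s u hu)]
        · cases s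
          · exact fun h => Bool.noConfusion (hb'.symm.trans (h.symm.trans hb))
          · exact fun h => Bool.noConfusion (hb'.symm.trans (h.trans hb))
        · exact Finset.insert_subset (hmem s u hu) hDe
        · rw [Finset.coe_insert]
          exact hDed.insert fun w hw _ => hdisj s u hu w hw
        · intro w hw
          rw [hinsert _ _ _ (hnot s u hu), hind w hw]
          congr 1
          rw [edgeCount, Fintype.sum_eq_single s]
          · simp [hu, hb]
          · intro s' hs'
            obtain rfl : s' = !s := Bool.eq_not.mpr hs'
            simp [hb']
      -- The selections of only the left and only the right edge. They remain two selections when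
      -- both edges come from the same gate.
      rw [Fintype.sum_eq_add (fun s => !s) (fun s => s)
        (fun h => by simpa using congrFun h true),
        hone _ false l hl rfl rfl, hone _ true r hr rfl rfl, ← add_mul, ← map_add, ← hprod, hval,
        hlab]
      rintro b ⟨hb₁, hb₂⟩
      refine hzero b ?_
      rw [if_pos hvD, hK.add v l r hlab, if_neg]
      exact fun hb => (eq_id_or_eq_not b hb).elim hb₂ hb₁
    | .mul l r =>
      have hl : (Φ.label v).child false = some l := by rw [hlab]; rfl
      have hr : (Φ.label v).child true = some r := by rw [hlab]; rfl
      have hlr := hΦ v l r hlab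
      have hln : l ∉ insert r (D.erase v) := by
        rw [Finset.mem_insert, not_or]
        refine ⟨?_, hnot _ l hl⟩
        rintro rfl
        exact Set.disjoint_left.mp hlr (Φ.mem_subcircuit_self l) (Φ.mem_subcircuit_self l)
      rw [Fintype.sum_eq_single (fun _ => true), hstep _ (insert l (insert r (D.erase v))),
        if_pos hvD, hK.mul v l r hlab, if_pos rfl, one_mul, Finset.prod_insert hln,
        Finset.prod_insert (hnot _ r hr), ← mul_assoc, ← map_mul, ← hprod, hval, hlab]
      · exact Finset.insert_subset (hmem _ l hl) (Finset.insert_subset (hmem _ r hr) hDe)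
      · rw [Finset.coe_insert, Finset.coe_insert]
        refine (hDed.insert fun w hw _ => hdisj _ r hr w hw).insert fun w hw _ => ?_
        rcases hw with rfl | hw
        · exact hlr
        · exact hdisj _ l hl w hw
      · intro u hu
        rw [hinsert _ _ _ hln, hinsert _ _ _ (hnot _ r hr), hind u hu, edgeCount,
          Fintype.sum_bool, hl, hr, add_assoc]
        simp
      · intro b hb
        exact hzero b (by rw [if_pos hvD, hK.mul v l r hlab, if_neg hb])

/-- The value of a multiplicatively disjoint circuit is a sum over all selections of edges. -/
theorem MultiplicativelyDisjoint.sum_prod_weight [Fintype Φ.Gate] [DecidableEq Φ.Gate]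
    (hΦ : Φ.MultiplicativelyDisjoint) (hK : Φ.IsGateWeight ρ K) (o : Φ.Gate) :
    ∑ h : Φ.Gate → Bool → Bool, ∏ v, K v (Φ.demand S {o} h v) (h v) = aeval ρ (Φ.value o) := by
  have := hΦ.sum_prod_eq hK Finset.univ {o} (by simp) (by simp) (by simp)
  simp only [Finset.mem_univ, not_true_eq_false, false_imp_iff, implies_true, Finset.filter_true,
    Finset.prod_singleton] at this
  convert this

end Circuit

end Valiant

namespace Valiant

/-! ### Sums over bits of products of affine forms -/

section bits

variable {F R I : Type*} [CommRing F] [CommRing R] [Algebra F R] [Fintype I]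

/-- The affine forms in bits with coefficients from `A`. -/
def bitAffine (I : Type*) [Fintype I] (A : Submodule F R) : Submodule F ((I → Bool) → R) where
  carrier := {φ | ∃ c ∈ A, ∃ a : I → R, (∀ i, a i ∈ A) ∧
    φ = fun E => c + ∑ i, if E i then a i else 0}
  add_mem' := by
    rintro _ _ ⟨c, hc, a, ha, rfl⟩ ⟨c', hc', a', ha', rfl⟩
    refine ⟨c + c', add_mem hc hc', a + a', fun i => add_mem (ha i) (ha' i), ?_⟩
    funext E
    rw [Pi.add_apply, add_add_add_comm, ← Finset.sum_add_distrib]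
    congr 1
    refine Finset.sum_congr rfl fun i _ => ?_
    split_ifs <;> simp
  zero_mem' := ⟨0, zero_mem A, 0, fun _ => zero_mem A, by funext E; simp⟩
  smul_mem' := by
    rintro r _ ⟨c, hc, a, ha, rfl⟩
    refine ⟨r • c, A.smul_mem r hc, r • a, fun i => A.smul_mem r (ha i), ?_⟩
    funext E
    rw [Pi.smul_apply, smul_add, Finset.smul_sum]
    congr 1
    refine Finset.sum_congr rfl fun i _ => ?_
    split_ifs <;> simp

theorem const_mem_bitAffine {A : Submodule F R} {c : R} (hc : c ∈ A) :
    (fun _ => c) ∈ bitAffine I A :=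
  ⟨c, hc, 0, fun _ => zero_mem A, by funext E; simp⟩

theorem bit_mem_bitAffine [DecidableEq I] {A : Submodule F R} (h1 : 1 ∈ A) (i : I) :
    (fun E : I → Bool => if E i then (1 : R) else 0) ∈ bitAffine I A := by
  refine ⟨0, zero_mem A, Pi.single i 1, fun j => ?_, ?_⟩
  · rcases eq_or_ne j i with rfl | h
    · simpa using h1
    · simp [Pi.single_eq_of_ne h]
  · funext E
    rw [zero_add, Finset.sum_eq_single i]
    · simp
    · intro j _ h
      simp [Pi.single_eq_of_ne h]
    · simp

/-- The bits of `φ` carry scalar coefficients only, so multiplying by a member of `A` does not leave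
`A`. Demands have this form. -/
theorem mul_const_mem_bitAffine {A : Submodule F R} {φ : (I → Bool) → R}
    (hφ : φ ∈ bitAffine I (Submodule.span F {(1 : R)})) {a : R} (ha : a ∈ A) :
    (fun E => φ E * a) ∈ bitAffine I A := by
  have key : ∀ c ∈ Submodule.span F {(1 : R)}, c * a ∈ A := by
    intro c hc
    obtain ⟨r, rfl⟩ := Submodule.mem_span_singleton.mp hc
    rw [smul_mul_assoc, one_mul]
    exact A.smul_mem r ha
  obtain ⟨c, hc, b, hb, rfl⟩ := hφ
  refine ⟨c * a, key c hc, fun i => b i * a, fun i => key _ (hb i), ?_⟩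
  funext E
  rw [add_mul, Finset.sum_mul]
  congr 1
  refine Finset.sum_congr rfl fun i _ => ?_
  split_ifs <;> simp

end bits

/-- The scalar `r` becomes one further factor that involves no bits; it supplies the extra index in
`Fin (Fintype.card J + 1)`. -/
theorem exists_permanent_eq_sum_prod {F R I J : Type*} [Field F] [CommRing R] [Algebra F R]
    [Fintype I] [DecidableEq I] [Fintype J] (h2 : (2 : F) ≠ 0) {A : Submodule F R}
    (h1 : (1 : R) ∈ A) {r : R} (hr : r ∈ A) {φ : J → (I → Bool) → R}
    (hφ : ∀ j, φ j ∈ bitAffine I A) {n : ℕ}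
    (hn : n = (Fintype.card J + 1) + 5 * (Fintype.card I * (Fintype.card J + 1))) :
    ∃ B : Matrix (Fin n) (Fin n) R, (∀ i j, B i j ∈ A) ∧
      B.permanent = r * ∑ E, ∏ j, φ j E := by
  choose c hc a ha hφ using hφ
  obtain ⟨B, hB, hB'⟩ := exists_permanent_eq_sum h2 h1
    (c := Fin.cons r (c ∘ (Fintype.equivFin J).symm))
    (a := Fin.cons 0 (a ∘ (Fintype.equivFin J).symm))
    (Fin.cases hr fun j => hc _) (Fin.cases (fun _ => zero_mem A) fun j => ha _) hn
  refine ⟨B, hB, hB'.trans ?_⟩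
  rw [Finset.mul_sum]
  refine Finset.sum_congr rfl fun E _ => ?_
  rw [Fin.prod_univ_succ, ← (Fintype.equivFin J).symm.prod_comp]
  simp [hφ]

/-! ### Gate weights as products of affine forms. -/

namespace Circuit

open MvPolynomial

section gateForm

variable {F R X κ V : Type*} [Field F] [CommRing R] [Algebra F R]

/-- Four affine forms in bits whose product is the weight of a gate. -/
def gateForm (x : X → R) (e : κ → Bool) (lab : GateLabel F (X ⊕ κ) V) (d : R) (b : Bool → Bool) :
    Fin 4 → R :=
  let h₀ : R := if b false then 1 else 0
  let h₁ : R := if b true then 1 else 0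
  match lab with
  | .const c => ![1 + (c - 1) • d, 1 - h₀, 1 - h₁, 1]
  | .var (.inl a) => ![1 + d * (x a - 1), 1 - h₀, 1 - h₁, 1]
  | .var (.inr i) =>
    let ε : R := if e i then 1 else 0
    ![1 - d + ε, 1 + (2⁻¹ : F) • (d - ε), 1 - h₀, 1 - h₁]
  | .add _ _ => ![h₀ + h₁ - d + 1, h₀ + h₁ - d - 1, h₀ + h₁ - d - (1 + 1), (2⁻¹ : F) • 1]
  | .mul _ _ => ![1 - h₀ - d, 1 - h₀ - d, 1 - h₁ - d, 1 - h₁ - d]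

/-- At a leaf, `1 - h₀` and `1 - h₁` exclude incoming edges, and the rest interpolates between 1 at
demand 0 and the value at demand 1; for a bit `ε` this takes two factors, since `d * ε` is not
affine. At a sum, the cubic in `h₀ + h₁ - d` is 1 at 0 and vanishes at -1, 1 and 2. At a product, `1
- h - d` is `1 - h` or `-h`, and squaring removes the sign. -/
theorem isGateWeight_gateForm (h2 : (2 : F) ≠ 0) (Φ : Circuit F (X ⊕ κ)) (x : X → R)
    (e e' : κ → Bool) (he : ∀ v i, Φ.label v = .var (.inr i) → e i = e' i) :
    Φ.IsGateWeight (Sum.elim x fun i => if e i then (1 : R) else 0)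
      fun v d b => ∏ k, gateForm x e' (Φ.label v) d b k := by
  have hη : 2 * algebraMap F R 2⁻¹ = 1 := by
    have : (2 : R) = algebraMap F R 2 := (map_ofNat _ 2).symm
    rw [this, ← map_mul, mul_inv_cancel₀ h2, map_one]
  have hb : ∀ b : Bool → Bool, b = fun s => cond s (b true) (b false) := fun b => by
    funext s; cases s <;> rfl
  constructor
  · intro v b
    rw [hb b]
    generalize b true = b₁, b false = b₀
    match Φ.label v with
    | .const c => cases b₀ <;> cases b₁ <;> simp [gateForm, Fin.prod_univ_four, _root_.funext_iff]
    | .var (.inl a) => cases b₀ <;> cases b₁ <;> simp [gateForm, Fin.prod_univ_four, _root_.funext_iff]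
    | .var (.inr i) =>
      cases b₀ <;> cases b₁ <;> cases h : e' i <;>
        simp [gateForm, Fin.prod_univ_four, _root_.funext_iff, h, Algebra.smul_def]
      linear_combination -hη
    | .add l r =>
      cases b₀ <;> cases b₁ <;>
        simp [gateForm, Fin.prod_univ_four, _root_.funext_iff, Algebra.smul_def]
      linear_combination hη
    | .mul l r => cases b₀ <;> cases b₁ <;> simp [gateForm, Fin.prod_univ_four, _root_.funext_iff]
  · intro v hv b
    have hval := Φ.value_eq v
    rw [hb b]
    generalize b true = b₁, b false = b₀
    match hlab : Φ.label v with
    | .const c =>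
      rw [hlab] at hval
      cases b₀ <;> cases b₁ <;>
        simp [gateForm, Fin.prod_univ_four, _root_.funext_iff, hval, Algebra.smul_def]
    | .var (.inl a) =>
      rw [hlab] at hval
      cases b₀ <;> cases b₁ <;> simp [gateForm, Fin.prod_univ_four, _root_.funext_iff, hval]
    | .var (.inr i) =>
      rw [hlab] at hval
      have := he v i hlab
      cases b₀ <;> cases b₁ <;> cases h : e i <;>
        simp [gateForm, Fin.prod_univ_four, _root_.funext_iff, hval, h, ← this]
    | .add l r => simpa [hlab, GateLabel.child] using hv false
    | .mul l r => simpa [hlab, GateLabel.child] using hv false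
  · intro v l r hlab b
    rw [hb b]
    generalize b true = b₁, b false = b₀
    cases b₀ <;> cases b₁ <;>
      simp [gateForm, Fin.prod_univ_four, hlab, Algebra.smul_def]
    all_goals linear_combination hη
  · intro v l r hlab b
    rw [hb b]
    generalize b true = b₁, b false = b₀
    cases b₀ <;> cases b₁ <;> simp [gateForm, Fin.prod_univ_four, hlab, _root_.funext_iff]

end gateForm

end Circuit

end Valiant

namespace Valiant

/-! ### Sums over bits of circuits as permanents. -/

namespace Circuit

open MvPolynomial

variable {F R X κ V : Type*} [Field F] [CommRing R] [Algebra F R]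

theorem demand_mem_bitAffine {σ I : Type*} (Φ : Circuit F σ) [Fintype Φ.Gate] [Fintype I]
    [DecidableEq I] (D : Finset Φ.Gate) (v : Φ.Gate) (ι : Φ.Gate × Bool → I) :
    (fun E : I → Bool => Φ.demand R D (fun w s => E (ι (w, s))) v) ∈
      bitAffine I (Submodule.span F {(1 : R)}) := by
  have h1 : (1 : R) ∈ Submodule.span F {(1 : R)} := Submodule.mem_span_singleton_self 1
  refine add_mem (const_mem_bitAffine ?_) ?_
  · split_ifs
    exacts [h1, zero_mem _]
  · rw [← Finset.sum_fn]
    refine sum_mem fun w _ => ?_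
    simp only [edgeCount]
    rw [← Finset.sum_fn]
    refine sum_mem fun s _ => ?_
    by_cases h : (Φ.label w).child s = some v
    · simpa only [h, true_and] using bit_mem_bitAffine h1 (ι (w, s))
    · simpa only [h, false_and, if_false] using const_mem_bitAffine (zero_mem _)

theorem sum_sum_bits {U M : Type*} [Fintype V] [DecidableEq V] [Fintype U] [DecidableEq U]
    [AddCommMonoid M] (φ : (V → Bool → Bool) → (U → Bool) → M) :
    ∑ E : (V × Bool) ⊕ U → Bool, φ (fun v s => E (.inl (v, s))) (fun i => E (.inr i)) =
      ∑ e, ∑ h, φ h e := by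
  rw [← Fintype.sum_prod_type_right' (f := φ)]
  exact ((Equiv.sumArrowEquivProdArrow (V × Bool) U Bool).trans
    (Equiv.prodCongr (Equiv.curry V Bool Bool) (Equiv.refl _))).sum_comp fun q => φ q.1 q.2

theorem gateForm_mem_bitAffine {I : Type*} [Fintype I] [DecidableEq I] {A : Submodule F R}
    (h1 : (1 : R) ∈ A) (x : X → R) (e : (I → Bool) → κ → Bool) (lab : GateLabel F (X ⊕ κ) V)
    (hx : ∀ a, lab = .var (.inl a) → x a ∈ A)
    (he : ∀ i, lab = .var (.inr i) → ∃ k, ∀ E : I → Bool, e E i = E k) {d : (I → Bool) → R}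
    (hd : d ∈ bitAffine I (Submodule.span F {(1 : R)})) (ι : Bool → I) (k : Fin 4) :
    (fun E => gateForm x (e E) lab (d E) (fun s => E (ι s)) k) ∈ bitAffine I A := by
  have h1' : (fun _ => 1 : (I → Bool) → R) ∈ bitAffine I A := const_mem_bitAffine h1
  have hh := fun s => bit_mem_bitAffine h1 (ι s)
  have hd' : d ∈ bitAffine I A := by simpa using mul_const_mem_bitAffine hd h1
  match lab with
  | .const c =>
    fin_cases k
    · exact add_mem h1' (Submodule.smul_mem _ _ hd')
    · exact sub_mem h1' (hh _)
    · exact sub_mem h1' (hh _)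
    · exact h1'
  | .var (.inl a) =>
    fin_cases k
    · exact add_mem h1' (mul_const_mem_bitAffine hd (sub_mem (hx a rfl) h1))
    · exact sub_mem h1' (hh _)
    · exact sub_mem h1' (hh _)
    · exact h1'
  | .var (.inr i) =>
    obtain ⟨k', hk'⟩ := he i rfl
    have hε : (fun E => if e E i then (1 : R) else 0) ∈ bitAffine I A := by
      simpa only [hk'] using bit_mem_bitAffine h1 k'
    fin_cases k
    · exact add_mem (sub_mem h1' hd') hε
    · exact add_mem h1' (Submodule.smul_mem _ _ (sub_mem hd' hε))
    · exact sub_mem h1' (hh _)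
    · exact sub_mem h1' (hh _)
  | .add l r =>
    have hs := sub_mem (add_mem (hh false) (hh true)) hd'
    fin_cases k
    · exact add_mem hs h1'
    · exact sub_mem hs h1'
    · exact sub_mem hs (add_mem h1' h1')
    · exact Submodule.smul_mem _ _ h1'
  | .mul l r =>
    fin_cases k
    · exact sub_mem (sub_mem h1' (hh _)) hd'
    · exact sub_mem (sub_mem h1' (hh _)) hd'
    · exact sub_mem (sub_mem h1' (hh _)) hd'
    · exact sub_mem (sub_mem h1' (hh _)) hd'

/-- Summing a multiplicatively disjoint circuit over bits gives a permanent of affine forms. -/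
theorem MultiplicativelyDisjoint.exists_permanent_eq (h2 : (2 : F) ≠ 0) {Φ : Circuit F (X ⊕ κ)}
    [Fintype κ] [DecidableEq κ] (hΦ : Φ.MultiplicativelyDisjoint) (o : Φ.Gate) {A : Submodule F R}
    (h1 : (1 : R) ∈ A) (x : X → R) (hx : ∀ v a, Φ.label v = .var (.inl a) → x a ∈ A) :
    ∃ n ≤ (4 * Nat.card Φ.Gate + 1) * (15 * Nat.card Φ.Gate + 1),
      ∃ B : Matrix (Fin n) (Fin n) R, (∀ i j, B i j ∈ A) ∧
        B.permanent = ∑ e : κ → Bool,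
          aeval (Sum.elim x fun i => if e i then (1 : R) else 0) (Φ.value o) := by
  classical
  have := Φ.finite
  have := Fintype.ofFinite Φ.Gate
  -- Only bits that occur at a leaf are kept, because the number of bits is not bounded by the size.
  -- The others just multiply the sum by the number `c` of their assignments.
  let p : κ → Prop := fun i => ∃ v, Φ.label v = .var (.inr i)
  let I := (Φ.Gate × Bool) ⊕ {i // p i}
  let ext : ({i // p i} → Bool) → κ → Bool := fun e i => if h : p i then e ⟨i, h⟩ else false
  let φ : Φ.Gate × Fin 4 → (I → Bool) → R := fun j E =>
    gateForm x (ext fun i => E (.inr i)) (Φ.label j.1)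
      (Φ.demand R {o} (fun w s => E (.inl (w, s))) j.1) (fun s => E (.inl (j.1, s))) j.2
  have hφ : ∀ j, φ j ∈ bitAffine I A := by
    rintro ⟨v, k⟩
    refine gateForm_mem_bitAffine h1 x (fun E => ext fun i => E (.inr i)) (Φ.label v) (hx v) ?_
      (Φ.demand_mem_bitAffine {o} v Sum.inl) (fun s => .inl (v, s)) k
    intro i hi
    exact ⟨.inr ⟨i, v, hi⟩, fun E => dif_pos (⟨v, hi⟩ : p i)⟩
  let c := Fintype.card ({i // ¬ p i} → Bool)
  obtain ⟨B, hB, hB'⟩ := exists_permanent_eq_sum_prod h2 h1 (r := (c : R))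
    (by rw [← nsmul_one]; exact nsmul_mem h1 c) hφ rfl
  refine ⟨_, ?_, B, hB, hB'.trans ?_⟩
  -- Two edge bits per gate and at most one occurring bit per gate: the factor 15 is 5 times 3.
  · have hp : Fintype.card {i // p i} ≤ Fintype.card Φ.Gate := by
      refine Fintype.card_le_of_injective (fun i => i.2.choose) fun i j hij => ?_
      have := i.2.choose_spec.symm.trans ((congrArg Φ.label hij).trans j.2.choose_spec)
      simpa [Subtype.ext_iff] using this
    simp only [I, Fintype.card_prod, Fintype.card_sum, Fintype.card_fin, Fintype.card_bool,
      Nat.card_eq_fintype_card]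
    nlinarith
  · have key : ∀ e : κ → Bool, aeval (Sum.elim x fun i => if e i then (1 : R) else 0) (Φ.value o) =
        ∑ h : Φ.Gate → Bool → Bool, ∏ v, ∏ k, gateForm x (ext fun i => e i) (Φ.label v)
          (Φ.demand R {o} h v) (h v) k := by
      intro e
      refine (hΦ.sum_prod_weight (isGateWeight_gateForm h2 Φ x e (ext fun i => e i) ?_) o).symm
      intro v i hi
      change e i = if h : p i then e i else false
      exact (if_pos (⟨v, hi⟩ : p i)).symm
    simp only [key]
    rw [← (Equiv.piEquivPiSubtypeProd p fun _ => Bool).symm.sum_comp, Fintype.sum_prod_type]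
    have hext : ∀ q : ({i // p i} → Bool) × ({i // ¬ p i} → Bool),
        (fun i : {i // p i} => (Equiv.piEquivPiSubtypeProd p fun _ => Bool).symm q i) = q.1 := by
      intro q
      funext i
      exact dif_pos i.2
    simp only [hext, Finset.sum_const, Finset.card_univ, nsmul_eq_mul]
    rw [← Finset.mul_sum]
    refine congrArg (HMul.hMul _) (Eq.trans ?_ (sum_sum_bits fun h e => ∏ v, ∏ k,
      gateForm x (ext e) (Φ.label v) (Φ.demand R {o} h v) (h v) k))
    exact Finset.sum_congr rfl fun E _ => Fintype.prod_prod_type _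

end Circuit

end Valiant

namespace Valiant

/-! ### Comparing the classes -/

open MvPolynomial

theorem aeval_mem_of_totalDegree_le_one {F R σ : Type*} [CommSemiring F] [CommSemiring R]
    [Algebra F R] {p : MvPolynomial σ F} (hp : p.totalDegree ≤ 1) {A : Submodule F R}
    (h1 : (1 : R) ∈ A) {x : σ → R} (hx : ∀ i, x i ∈ A) : aeval x p ∈ A := by
  rw [p.as_sum, map_sum]
  refine sum_mem fun m hm => ?_
  rw [aeval_monomial, ← Algebra.smul_def]
  refine A.smul_mem _ ?_
  have hdeg : m.degree ≤ 1 := (le_totalDegree hm).trans hp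
  rcases eq_or_ne m 0 with rfl | h
  · simpa using h1
  · obtain ⟨i, hi⟩ := Finsupp.ne_iff.mp h
    have hle : Finsupp.single i 1 ≤ m := by
      rw [Finsupp.single_le_iff]
      exact Nat.one_le_iff_ne_zero.mpr hi
    have hadd := tsub_add_cancel_of_le hle
    have hd := congrArg Finsupp.degree hadd
    rw [map_add, Finsupp.degree_single] at hd
    rw [← hadd, (Finsupp.degree_eq_zero_iff (m - Finsupp.single i 1)).mp (by omega), zero_add]
    simpa using hx i

theorem eval_le_eval (p : Polynomial ℕ) {a b : ℕ} (h : a ≤ b) : p.eval a ≤ p.eval b := by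
  rw [Polynomial.eval_eq_sum, Polynomial.eval_eq_sum]
  exact Finset.sum_le_sum fun i _ => Nat.mul_le_mul_left _ (Nat.pow_le_pow_left h i)

section dc

variable {F X : Type*} [Field F]

theorem dc_le {s : ℕ} {A : Matrix (Fin s) (Fin s) (MvPolynomial X F)}
    (hA : ∀ i j, (A i j).totalDegree ≤ 1) : dc A.det ≤ s :=
  sInf_le ⟨s, rfl, A, hA, rfl⟩

theorem exists_det_of_dc_le {f : MvPolynomial X F} {k : ℕ} (h : dc f ≤ k) :
    ∃ s ≤ k, ∃ A : Matrix (Fin s) (Fin s) (MvPolynomial X F),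
      (∀ i j, (A i j).totalDegree ≤ 1) ∧ f = A.det := by
  have hne : {d : ℕ∞ | ∃ s : ℕ, d = s ∧ ∃ A : Matrix (Fin s) (Fin s) (MvPolynomial X F),
      (∀ i j, (A i j).totalDegree ≤ 1) ∧ f = A.det}.Nonempty := by
    rw [Set.nonempty_iff_ne_empty]
    intro h'
    rw [dc, h', sInf_empty] at h
    exact absurd h (by simp)
  obtain ⟨s, hs, hA⟩ := csInf_mem hne
  refine ⟨s, ?_, hA⟩
  rw [dc, hs] at h
  exact_mod_cast h

theorem dc_le_of_isProjection_DET {f : MvPolynomial X F} {N : ℕ}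
    (h : IsProjection f ((DET F).poly N)) : dc f ≤ N := by
  obtain ⟨a, rfl⟩ := h
  change Fin N × Fin N → F ⊕ X at a
  change dc (aeval (fun y : Fin N × Fin N => Sum.elim C MvPolynomial.X (a y)) (Matrix.det
    (Matrix.of fun i j : Fin N => (MvPolynomial.X (i, j) : MvPolynomial (Fin N × Fin N) F)))) ≤ _
  rw [AlgHom.map_det]
  refine dc_le fun i j => ?_
  rw [AlgHom.mapMatrix_apply, Matrix.map_apply, Matrix.of_apply, aeval_X]
  cases a (i, j) with
  | inl c => simp
  | inr x => simp [totalDegree_X]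

end dc

variable {F : Type*} [Field F]

/-- No bits are summed over, and weakly skew circuits are multiplicatively disjoint. -/
theorem VBP_subset_VNP : VBP F ⊆ VNP F := by
  rintro f ⟨Φ, hΦ, hsize⟩
  refine ⟨fun _ => 0, fun n => rename Sum.inl (f.poly n),
    ⟨fun n => (Φ n).mapVar Sum.inl, fun n => ⟨?_, ?_⟩, ?_⟩, fun n => ?_⟩
  · exact (((Φ n).mapVarEmbedding Sum.inl).weaklySkew (hΦ n).1).multiplicativelyDisjoint
  · obtain ⟨o, ho⟩ := (hΦ n).2
    exact ⟨o, (((Φ n).mapVarEmbedding Sum.inl).value o).trans (congrArg _ ho)⟩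
  · simpa only [Circuit.mapVar_size] using hsize
  · rw [Fintype.sum_unique, aeval_rename]
    exact (aeval_X_left_apply _).symm

/-- A polynomial bound for the determinantal complexity of the permanents gives weakly skew circuits
for sums over bits of multiplicatively disjoint circuits. -/
theorem exists_weaklySkew_of_dc (h2 : (2 : F) ≠ 0) {p : Polynomial ℕ}
    (hp : ∀ n, dc ((PER F).poly n) ≤ ((p.eval n : ℕ) : ℕ∞)) {σ κ : Type*} [Fintype κ]
    [DecidableEq κ] {Φ : Circuit F (σ ⊕ κ)} (hΦ : Φ.MultiplicativelyDisjoint)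
    {g : MvPolynomial (σ ⊕ κ) F} (hg : Φ.Computes g) {w : ℕ} (hw : 2 * Φ.size + 1 ≤ w) :
    ∃ Ψ : Circuit F σ, Ψ.WeaklySkew ∧
      Ψ.Computes (∑ e : κ → Bool, aeval (Sum.elim X fun i => if e i then 1 else 0) g) ∧
      Ψ.size ≤ 3 * (((p.eval ((4 * w + 1) * (15 * w + 1)) + 1) ^ 3 + 1) * (w + 1) + 1) ^ 2 := by
  obtain ⟨o, rfl⟩ := hg
  let Φ' := Φ.prune o
  have hcard : Nat.card Φ'.Gate ≤ w := (Φ.card_prune_le o).trans hw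
  have := Φ'.finite
  -- The number of variables of the sequence is not bounded either, so only those that occur in the
  -- pruned circuit may enter the size.
  let Y : Set σ := {a | ∃ v, Φ'.label v = .var (.inl a)}
  let γ : Y → Φ'.Gate := fun a => a.2.choose
  have hγ : Function.Injective γ := fun a b hab => by
    have := a.2.choose_spec.symm.trans ((congrArg Φ'.label hab).trans b.2.choose_spec)
    simpa [Subtype.ext_iff] using this
  have hY : Y.Finite := Set.finite_coe_iff.mp (Finite.of_injective γ hγ)
  have hYcard : Y.ncard ≤ w := (Nat.card_le_card_of_injective γ hγ).trans hcard
  obtain ⟨n, hn, B, hB, hB'⟩ := ((Φ.pruneEmbedding o).multiplicativelyDisjoint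
    hΦ).exists_permanent_eq h2 (Φ.pruneRoot o) (one_mem_affineSpan (F := F) Y) X
    fun v a hv => X_mem_affineSpan ⟨v, hv⟩
  obtain ⟨s, hs, A, hA, hdet⟩ := exists_det_of_dc_le (X := Fin n × Fin n)
    (f := Matrix.permanent (Matrix.of fun i j : Fin n => X (i, j))) (hp n)
  -- The determinantal formula is an identity of polynomials, so the affine entries of `B` can be
  -- substituted for the variables of the permanent.
  have hperm : B.permanent = (Matrix.of fun i j => aeval (fun q : Fin n × Fin n => B q.1 q.2)
      (A i j)).det := by
    have := congrArg (aeval fun q : Fin n × Fin n => B q.1 q.2) hdet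
    rw [AlgHom.map_det] at this
    refine Eq.trans ?_ this
    simp [Matrix.permanent]
  obtain ⟨Ψ, hΨ, hΨ', hsize⟩ := exists_weaklySkew_det
    (Matrix.of fun i j => aeval (fun q : Fin n × Fin n => B q.1 q.2) (A i j)) hY
    fun i j => aeval_mem_of_totalDegree_le_one (hA i j) (one_mem_affineSpan Y) fun q => hB q.1 q.2
  refine ⟨Ψ, hΨ, ?_, hsize.trans ?_⟩
  · rw [← hperm, hB', Φ.prune_value] at hΨ'
    exact hΨ'
  · have hs' : s ≤ p.eval ((4 * w + 1) * (15 * w + 1)) :=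
      hs.trans (eval_le_eval p (hn.trans (by gcongr)))
    gcongr

theorem VNP_subset_VBP (h2 : (2 : F) ≠ 0)
    (hdc : PolynomiallyBounded fun n => dc ((PER F).poly n)) : VNP F ⊆ VBP F := by
  rintro f ⟨m, g, ⟨Φ, hΦ, q, hq⟩, hf⟩
  obtain ⟨p, hp⟩ := hdc
  have hq' : ∀ n, 2 * (Φ n).size + 1 ≤ 2 * q.eval n + 1 := fun n => by
    have : (Φ n).size ≤ q.eval n := Nat.cast_le.mp (hq n)
    omega
  have key := fun n => exists_weaklySkew_of_dc h2 hp (hΦ n).1 (hΦ n).2 (hq' n)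
  choose Ψ hΨ hΨ' hsize using key
  refine ⟨Ψ, fun n => ⟨hΨ n, ?_⟩, ?_⟩
  · rw [hf n]
    exact hΨ' n
  · let w : Polynomial ℕ := 2 * q + 1
    refine ⟨3 * (((p.comp ((4 * w + 1) * (15 * w + 1)) + 1) ^ 3 + 1) * (w + 1) + 1) ^ 2,
      fun n => ?_⟩
    refine Nat.cast_le.mpr ((hsize n).trans (le_of_eq ?_))
    simp [w]

end Valiant

namespace Valiant

/-! ### The permanents are a `p`-definable sequence -/

open MvPolynomial

/-- Ryser's formula. -/
theorem permanent_eq_sum_bits {ι R : Type*} [Fintype ι] [DecidableEq ι] [CommRing R]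
    (M : Matrix ι ι R) :
    M.permanent = ∑ e : ι → Bool, (∏ j, if e j then 1 else -1) *
      ∏ i, ∑ j, if e j then M j i else 0 := by
  -- Inclusion and exclusion: the sum factors over `j`, with factor 1 when `j` is in the image of
  -- `φ` and 1 - 1 = 0 otherwise.
  have hinner : ∀ φ : ι → ι, ∑ e : ι → Bool, (∏ j, if e j then (1 : R) else -1) *
      ∏ i, (if e (φ i) then 1 else 0) = if Function.Bijective φ then 1 else 0 := by
    intro φ
    have h1 : ∀ e : ι → Bool, (∏ j, if e j then (1 : R) else -1) *
        ∏ i, (if e (φ i) then (1 : R) else 0) = ∏ j, ((if e j then (1 : R) else -1) *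
          ∏ i with φ i = j, if e j then (1 : R) else 0) := by
      intro e
      rw [Finset.prod_mul_distrib,
        ← Finset.prod_fiberwise Finset.univ φ fun i => if e (φ i) then (1 : R) else 0]
      refine congrArg _ (Finset.prod_congr rfl fun j _ => Finset.prod_congr rfl fun i hi => ?_)
      rw [(Finset.mem_filter.mp hi).2]
    have h2 : ∀ j, ∑ b : Bool, ((if b then (1 : R) else -1) *
        ∏ i with φ i = j, if b then (1 : R) else 0) = if ∃ i, φ i = j then 1 else 0 := by
      intro j
      rw [Fintype.sum_bool]
      by_cases h : ∃ i, φ i = j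
      · obtain ⟨i, hi⟩ := h
        have hmem : i ∈ Finset.univ.filter fun i => φ i = j := by simpa using hi
        rw [Finset.prod_eq_zero hmem (f := fun _ => if false = true then (1 : R) else 0) (by simp),
          if_pos (c := ∃ i, φ i = j) ⟨i, hi⟩]
        simp
      · rw [Finset.filter_eq_empty_iff.mpr fun i _ hi => h ⟨i, hi⟩, if_neg h]
        simp
    simp only [h1]
    have hprod := Finset.prod_univ_sum (fun _ : ι => (Finset.univ : Finset Bool)) fun j b =>
      (if b then (1 : R) else -1) * ∏ i with φ i = j, if b then (1 : R) else 0
    rw [Fintype.piFinset_univ] at hprod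
    rw [← hprod]
    simp only [h2]
    rw [Finset.prod_ite_zero]
    by_cases h : Function.Bijective φ
    · rw [if_pos h, if_pos fun j _ => h.surjective j, Finset.prod_const_one]
    · rw [if_neg h, if_neg]
      exact fun h' => h (Finite.surjective_iff_bijective.mp fun j => h' j (Finset.mem_univ j))
  have hexp : ∀ e : ι → Bool, ∏ i, ∑ j, (if e j then M j i else 0) =
      ∑ φ : ι → ι, (∏ i, M (φ i) i) * ∏ i, if e (φ i) then 1 else 0 := by
    intro e
    rw [Finset.prod_univ_sum, Fintype.piFinset_univ]
    refine Finset.sum_congr rfl fun φ _ => ?_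
    rw [← Finset.prod_mul_distrib]
    simp
  simp only [hexp, Finset.mul_sum]
  rw [Finset.sum_comm]
  simp only [mul_left_comm _ (∏ i, M _ i), ← Finset.mul_sum, hinner, mul_ite, mul_one, mul_zero]
  rw [← Finset.sum_filter, Matrix.permanent]
  refine Finset.sum_bij (fun σ _ => σ) ?_ ?_ ?_ ?_
  · exact fun σ _ => Finset.mem_filter.mpr ⟨Finset.mem_univ _, σ.bijective⟩
  · exact fun σ _ τ _ h => Equiv.coe_fn_injective h
  · exact fun φ hφ => ⟨Equiv.ofBijective φ (Finset.mem_filter.mp hφ).2, Finset.mem_univ _, rfl⟩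
  · exact fun _ _ => rfl

theorem partialProd_last {M : Type*} [CommMonoid M] {n : ℕ} (f : Fin n → M) :
    Fin.partialProd f (Fin.last n) = ∏ i, f i := by
  rw [Fin.partialProd, Fin.val_last, List.take_of_length_le (by simp), List.prod_ofFn]

/-- A product of sums of `n` terms each, multiplied with `n` further factors, is computed by a small
weakly skew circuit. -/
theorem exists_weaklySkew_prod_mul_prod_sum {F σ : Type*} [Field F] {n : ℕ} {Y : Set σ}
    (hY : Y.Finite) {c : Fin n → MvPolynomial σ F} {a b : Fin n → Fin n → MvPolynomial σ F}
    (hc : ∀ i, c i ∈ affineSpan F Y) (ha : ∀ i j, a i j ∈ affineSpan F Y)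
    (hb : ∀ i j, b i j ∈ affineSpan F Y) :
    ∃ Φ : Circuit F σ, Φ.WeaklySkew ∧ Φ.Computes ((∏ i, c i) * ∏ i, ∑ j, a i j * b i j) ∧
      Φ.size ≤ 3 * ((2 * (n + 1) + n ^ 2) * (Y.ncard + 1) + 1) ^ 2 := by
  let V := (Fin (n + 1) ⊕ Fin (n + 1)) ⊕ (Fin n × Fin n)
  -- The products `b i j * q i` are unknowns of their own, because `a i j * b i j` is not an
  -- admissible affine coefficient.
  let q : Fin (n + 1) → MvPolynomial σ F := fun k =>
    Fin.partialProd c (Fin.last n) * Fin.partialProd (fun i => ∑ j, a i j * b i j) k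
  obtain ⟨p, hp₁, hp₂, hp₃⟩ : ∃ p : V → MvPolynomial σ F,
      (∀ k, p (.inl (.inl k)) = Fin.partialProd c k) ∧ (∀ k, p (.inl (.inr k)) = q k) ∧
      ∀ i j, p (.inr (i, j)) = b i j * q i.castSucc :=
    ⟨Sum.elim (Sum.elim (Fin.partialProd c) q) fun k => b k.1 k.2 * q k.1.castSucc,
      fun _ => rfl, fun _ => rfl, fun _ _ => rfl⟩
  obtain ⟨r, hr₁, hr₂, hr₃⟩ : ∃ r : V → ℕ, (∀ k, r (.inl (.inl k)) = k) ∧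
      (∀ k, r (.inl (.inr k)) = n + 1 + 2 * k) ∧ ∀ i j, r (.inr (i, j)) = n + 1 + 2 * i + 1 :=
    ⟨Sum.elim (Sum.elim (fun k => k) fun k => n + 1 + 2 * k) fun k => n + 1 + 2 * k.1 + 1,
      fun _ => rfl, fun _ => rfl, fun _ _ => rfl⟩
  have hp : ∀ v, p v ∈ recursionSpan r p Y (r v) := by
    rintro ((k | k) | ⟨i, j⟩)
    · induction k using Fin.cases with
      | zero =>
        rw [hp₁, Fin.partialProd_zero]
        exact one_mem_recursionSpan
      | succ k =>
        rw [hp₁, Fin.partialProd_succ, mul_comm, ← hp₁]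
        exact mul_mem_recursionSpan (by simp [hr₁]) (hc k)
    · induction k using Fin.cases with
      | zero =>
        have : p (.inl (.inr 0)) = p (.inl (.inl (Fin.last n))) := by
          rw [hp₂, hp₁]
          simp [q]
        rw [this]
        exact mem_recursionSpan (by simp [hr₁, hr₂])
      | succ k =>
        have : p (.inl (.inr k.succ)) = ∑ j, a k j * p (.inr (k, j)) := by
          simp only [hp₂, hp₃, q, Fin.partialProd_succ, Finset.mul_sum]
          exact Finset.sum_congr rfl fun j _ => by ring
        rw [this]
        refine sum_mem fun j _ => mul_mem_recursionSpan ?_ (ha k j)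
        rw [hr₂, hr₃, Fin.val_succ]
        omega
    · rw [hp₃, ← hp₂]
      refine mul_mem_recursionSpan ?_ (hb i j)
      rw [hr₂, hr₃, Fin.val_castSucc]
      omega
  obtain ⟨Φ, hΦ, hΦ', hsize⟩ := exists_weaklySkew_of_mem_recursionSpan r p hY hp
    (.inl (.inr (Fin.last n)))
  refine ⟨Φ, hΦ, ?_, hsize.trans (le_of_eq ?_)⟩
  · simpa only [hp₂, q, partialProd_last] using hΦ'
  · simp only [V, Fintype.card_sum, Fintype.card_prod, Fintype.card_fin]
    ring

/-- In Ryser's formula the sign of a bit `e` is the affine form `e + e - 1`, and the choice of an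
entry by a bit is the product of the two. -/
theorem PER_mem_VNP (F : Type*) [Field F] : PER F ∈ VNP F := by
  let e : ∀ n, Fin n → MvPolynomial ((Fin n × Fin n) ⊕ Fin n) F := fun n i => X (.inr i)
  let x : ∀ n, Fin n → Fin n → MvPolynomial ((Fin n × Fin n) ⊕ Fin n) F := fun n i j =>
    X (.inl (i, j))
  have hmem : ∀ n k, (X k : MvPolynomial ((Fin n × Fin n) ⊕ Fin n) F) ∈ affineSpan F Set.univ :=
    fun n k => X_mem_affineSpan (Set.mem_univ k)
  have key := fun n => exists_weaklySkew_prod_mul_prod_sum (F := F)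
    (Set.finite_univ (α := (Fin n × Fin n) ⊕ Fin n)) (c := fun i => e n i + e n i - 1)
    (a := fun _ j => e n j) (b := fun i j => x n j i)
    (fun i => sub_mem (add_mem (hmem n _) (hmem n _)) (one_mem_affineSpan _)) (fun _ _ => hmem n _)
    fun _ _ => hmem n _
  choose Φ hΦ hΦ' hsize using key
  refine ⟨fun n => n, fun n => (∏ i, (e n i + e n i - 1)) * ∏ i, ∑ j, e n j * x n j i,
    ⟨Φ, fun n => ⟨(hΦ n).multiplicativelyDisjoint, hΦ' n⟩, ?_⟩, fun n => ?_⟩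
  · refine ⟨3 * ((2 * (Polynomial.X + 1) + Polynomial.X ^ 2) *
      (Polynomial.X * Polynomial.X + Polynomial.X + 1) + 1) ^ 2, fun n => ?_⟩
    refine Nat.cast_le.mpr ((hsize n).trans (le_of_eq ?_))
    simp [Set.ncard_univ, Nat.card_eq_fintype_card]
  · have hval : ∀ ε : Fin n → Bool, aeval (Sum.elim (X : _ → MvPolynomial (Fin n × Fin n) F)
        fun i => if ε i then 1 else 0)
          ((∏ i, (e n i + e n i - 1)) * ∏ i, ∑ j, e n j * x n j i) =
        (∏ j, if ε j then 1 else -1) * ∏ i, ∑ j, if ε j then X (j, i) else 0 := by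
      intro ε
      simp only [e, x, map_mul, map_prod, map_sum, map_sub, map_add, map_one, aeval_X,
        Sum.elim_inl, Sum.elim_inr]
      congr 1
      · refine Finset.prod_congr rfl fun j _ => ?_
        split_ifs <;> simp
      · refine Finset.prod_congr rfl fun i _ => Finset.sum_congr rfl fun j _ => ?_
        split_ifs <;> simp
    exact (permanent_eq_sum_bits _).trans (Finset.sum_congr rfl fun ε _ => (hval ε).symm)

end Valiant

/-! ### The cycle of implications. -/

namespace Valiant

variable {F : Type*} [Field F]

theorem isPProjection_DET_of_mem_VBP {f : PolySeq F} (hf : f ∈ VBP F) :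
    IsPProjection f (DET F) := by
  obtain ⟨Φ, hΦ, p, hp⟩ := hf
  choose N hN hproj using fun n => (hΦ n).1.exists_isProjection_DET (hΦ n).2
  refine ⟨N, ⟨2 * p + 2, fun n => Nat.cast_le.mpr ((hN n).trans ?_)⟩, hproj⟩
  have : (Φ n).size ≤ p.eval n := Nat.cast_le.mp (hp n)
  simpa using this

theorem IsPProjection.polynomiallyBounded_dc {f : PolySeq F} (hf : IsPProjection f (DET F)) :
    PolynomiallyBounded fun n => dc (f.poly n) := by
  obtain ⟨t, ⟨p, hp⟩, ht⟩ := hf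
  exact ⟨p, fun n => (dc_le_of_isProjection_DET (ht n)).trans (hp n)⟩

end Valiant

theorem mainTheorem3 (F : Type*) [Field F] (hF : ringChar F ≠ 2) :
    (Valiant.VBP F ≠ Valiant.VNP F ↔ ¬ Valiant.IsPProjection (Valiant.PER F) (Valiant.DET F)) ∧
    (Valiant.VBP F ≠ Valiant.VNP F ↔
      ¬ Valiant.PolynomiallyBounded fun n => Valiant.dc ((Valiant.PER F).poly n)) := by
  have h₁ : Valiant.VBP F = Valiant.VNP F →
      Valiant.IsPProjection (Valiant.PER F) (Valiant.DET F) := fun h =>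
    Valiant.isPProjection_DET_of_mem_VBP (h ▸ Valiant.PER_mem_VNP F)
  have h₂ : (Valiant.PolynomiallyBounded fun n => Valiant.dc ((Valiant.PER F).poly n)) →
      Valiant.VBP F = Valiant.VNP F := fun h =>
    Valiant.VBP_subset_VNP.antisymm (Valiant.VNP_subset_VBP (Ring.two_ne_zero hF) h)
  exact ⟨not_congr ⟨h₁, fun h => h₂ h.polynomiallyBounded_dc⟩,
    not_congr ⟨fun h => (h₁ h).polynomiallyBounded_dc, h₂⟩⟩
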